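/- **Setting.** Let $L_t,L_r,M,N$ be positive integers: the normalized lengths of a transmit and a receive array and their numbers of antennas. Put $\Delta_t=L_t/M$ and $\Delta_r=L_r/N$ (antenna separations) and $\alpha=L_t/L_r$ (load). For an array with $n$ antennas, separation $\Delta$ and length $L=n\Delta$ let $$s_{L,\Delta}(\Omega)=\tfrac1{\sqrt n}\bigl(1,e^{-2\pi j\Delta\Omega},\dots,e^{-2\pi j(n-1)\Delta\Omega}\bigr)^T,\qquad f_{L,\Delta}(\Omega)=s_{L,\Delta}(0)^H s_{L,\Delta}(\Omega),$$ and let $U_{L,\Delta}$ be the $n\times n$ matrix with columns $s_{L,\Delta}(k/L)$, $0\le k<n$. Let $dp$ be a measure on a space of paths. A channel instance $\mathcal C=(a,\Omega_t,\Omega_r)$ consists of measurable functions of the path $p$: the complex attenuation $a(p)$ and the directional cosines $\Omega_t(p),\Omega_r(p)\in[-1,1]$. Its angular-domain channel matrix $G\in\mathbb C^{N\times M}$ has the entries $$g_{n,m}=\sqrt{4L_tL_r}\int a(p)\,f_{L_r,\Delta_r}\!\Bigl(\Omega_r(p)-\frac n{L_r}\Bigr)\,f_{L_t,\Delta_t}\!\Bigl(\Omega_t(p)-\frac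 m{L_t}\Bigr)^{*}dp ,\qquad 0\le n<N,\ 0\le m<M .$$ Let $\tilde G$ agree with $G$ on $\mathcal N\times\mathcal M$ and vanish elsewhere, where $\mathcal N=\{0,\dots,L_r\}\cup\{N-L_r,\dots,N-1\}$ and $\mathcal M=\{0,\dots,L_t\}\cup\{M-L_t,\dots,M-1\}$ (as subsets of $\{0,\dots,N-1\}$ and $\{0,\dots,M-1\}$). For a covariance matrix $Q$ and $\tilde\gamma>0$ put $$C_{\rm opt}(Q;\tilde\gamma,G)=\log\det\bigl(I+\tilde\gamma\,G\,U_{L_t,\Delta_t}^H\,Q\,U_{L_t,\Delta_t}\,G^H\bigr).$$ The large-system limit means that $L_t,L_r,M,N\to\infty$ with $\Delta_r$ and $\alpha$ held fixed and $\Delta_t\in(0,1/2]$; "uniformly" always includes uniformity in $\Delta_t$. **Theorem.** Fix $\tilde\gamma>0$, $\Delta_r\in(0,1/2]$ and $\alpha>0$. Let $(s_l)$ be natural numbers with $s_l\to\infty$ and $s_l/l\to0$, and $\mathcal D_l=[-(1-s_l/l),\,1-s_l/l]$. For each system let $\mathfrak C$ be a class of channel instances and $\mathfrak S_M$ a set of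 positive semidefinite $M\times M$ matrices such that in the large-system limit, uniformly over $\mathfrak C$ and $\mathfrak S_M$: 1. $\Omega_t(p)\in\mathcal D_{L_t}$ and $\Omega_r(p)\in\mathcal D_{L_r}$ for all $p$; the total power $\int|a(p)|^2dp$ and the maximum singular value of $\min\{2L_t,2L_r\}^{-1/2}G$ are uniformly bounded; and the total amplitude is finite and subexponential in the array length: $\int|a(p)|\,dp\le e^{o(L_t)}$; 2. $\operatorname{Tr}\Sigma\le1$ for all $\Sigma\in\mathfrak S_M$, and the maximum eigenvalue of $2L_t\Sigma$ is uniformly bounded. Then, with $Q=U_{L_t,\Delta_t}\Sigma U_{L_t,\Delta_t}^H$, $$\frac{\bigl|C_{\rm opt}(Q;\tilde\gamma,G)-C_{\rm opt}(Q;\tilde\gamma,\tilde G)\bigr|}{2\min\{L_t,L_r\}}\longrightarrow0$$ in the large-system limit, uniformly for all $\Delta_t\in(0,1/2]$, $\Sigma\in\mathfrak S_M$ and $\mathcal C\in\mathfrak C$. -/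

import Mathlib

open Filter Topology MeasureTheory
open scoped Matrix ENNReal ComplexOrder

noncomputable section

/-- A pair of uniform linear arrays: normalized array lengths `Lt`, `Lr` and numbers `M`, `N` of
transmit and receive antennas. The antenna separations are `Lt / M` and `Lr / N`. -/
structure ArraySystem where
  Lt : ℕ
  Lr : ℕ
  M : ℕ
  N : ℕ
  Lt_pos : 0 < Lt
  Lr_pos : 0 < Lr
  M_pos : 0 < M
  N_pos : 0 < N

namespace ArraySystem

/-- Normalized transmit antenna separation. -/
def sepT (S : ArraySystem) : ℝ := (S.Lt : ℝ) / S.M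

/-- Normalized receive antenna separation. -/
def sepR (S : ArraySystem) : ℝ := (S.Lr : ℝ) / S.N

/-- The load. -/
def load (S : ArraySystem) : ℝ := (S.Lt : ℝ) / S.Lr

end ArraySystem

/-- The large-system limit: all of `Lt, Lr, M, N` tend to infinity while the receive separation is
kept equal to `Δr` and the load to `α`. The transmit separation is only restricted to `(0, 1/2]`, so
that a property which holds eventually along this filter holds uniformly in the transmit
separation. -/
def largeSystemLimit (Δr α : ℝ) : Filter ArraySystem :=
  (comap ArraySystem.Lt atTop ⊓ comap ArraySystem.Lr atTop ⊓
    comap ArraySystem.M atTop ⊓ comap ArraySystem.N atTop) ⊓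
  𝓟 {S | S.sepT ∈ Set.Ioc (0 : ℝ) (1 / 2) ∧ S.sepR = Δr ∧ S.load = α}

/-- The normalized spatial signature of an array with `n` antennas, separation `Δ`, in the
direction with directional cosine `Ω`. -/
def signature (n : ℕ) (Δ Ω : ℝ) : Fin n → ℂ := fun k =>
  ((1 / Real.sqrt n : ℝ) : ℂ) *
    Complex.exp (-(2 * Real.pi * Complex.I * ((k : ℕ) : ℂ) * (Δ : ℂ) * (Ω : ℂ)))

/-- `f(Ω) = s(0)ᴴ s(Ω)`. -/
def beam (n : ℕ) (Δ Ω : ℝ) : ℂ := star (signature n Δ 0) ⬝ᵥ signature n Δ Ω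

/-- The DFT matrix: its `k`-th column is the signature in direction `k / L`, where `L = n Δ`. -/
def dft (n : ℕ) (Δ : ℝ) : Matrix (Fin n) (Fin n) ℂ :=
  Matrix.of fun i k => signature n Δ (((k : ℕ) : ℝ) / (n * Δ)) i

/-- A channel instance over a space of paths `P`: attenuation and directional cosines. -/
structure ChannelInstance (P : Type*) [MeasurableSpace P] where
  a : P → ℂ
  Ωt : P → ℝ
  Ωr : P → ℝ
  measurable_a : Measurable a
  measurable_Ωt : Measurable Ωt
  measurable_Ωr : Measurable Ωr
  Ωt_mem : ∀ p, Ωt p ∈ Set.Icc (-1 : ℝ) 1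
  Ωr_mem : ∀ p, Ωr p ∈ Set.Icc (-1 : ℝ) 1

section Channel

variable {P : Type*} [MeasurableSpace P]

/-- The channel matrix in the angular domain. -/
def angularChannel (dp : Measure P) (S : ArraySystem) (C : ChannelInstance P) :
    Matrix (Fin S.N) (Fin S.M) ℂ :=
  Matrix.of fun n m =>
    ((Real.sqrt (4 * S.Lt * S.Lr) : ℝ) : ℂ) *
      ∫ p, C.a p * beam S.N S.sepR (C.Ωr p - ((n : ℕ) : ℝ) / S.Lr) *
        star (beam S.M S.sepT (C.Ωt p - ((m : ℕ) : ℝ) / S.Lt)) ∂dp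

/-- The index set `[0 : L] ∪ [n - L : n)` inside `[0 : n)`. -/
def effectiveIndices (n L : ℕ) : Set (Fin n) := {k | (k : ℕ) ≤ L ∨ n ≤ (k : ℕ) + L}

open Classical in
/-- The matrix with the entries outside the effective index sets replaced by zero. -/
def truncate (S : ArraySystem) (G : Matrix (Fin S.N) (Fin S.M) ℂ) :
    Matrix (Fin S.N) (Fin S.M) ℂ :=
  Matrix.of fun n m =>
    if n ∈ effectiveIndices S.N S.Lr ∧ m ∈ effectiveIndices S.M S.Lt then G n m else 0

/-- The constrained capacity `log det (I + γ G Uᴴ Q U Gᴴ)`. The determinant is real and at least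
one whenever `Q` is positive semidefinite and `γ` is nonnegative. -/
def capacity (S : ArraySystem) (Q : Matrix (Fin S.M) (Fin S.M) ℂ) (γ : ℝ)
    (G : Matrix (Fin S.N) (Fin S.M) ℂ) : ℝ :=
  Real.log (Matrix.det (1 + (γ : ℂ) •
    (G * (dft S.M S.sepT)ᴴ * Q * dft S.M S.sepT * Gᴴ))).re

open scoped Matrix.Norms.L2Operator in
/-- The maximum singular value of a matrix, i.e. its operator norm for the Euclidean norms. -/
def maxSingularValue {m n : ℕ} (A : Matrix (Fin m) (Fin n) ℂ) : ℝ := ‖A‖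

/-- A slowly diverging sequence. -/
def SlowlyDiverging (s : ℕ → ℕ) : Prop :=
  Tendsto s atTop atTop ∧ Tendsto (fun l => (s l : ℝ) / l) atTop (𝓝 0)

/-- The set `[-(1 - s_l / l), 1 - s_l / l]`. -/
def directionSet (s : ℕ → ℕ) (l : ℕ) : Set ℝ :=
  Set.Icc (-(1 - (s l : ℝ) / l)) (1 - (s l : ℝ) / l)

/-- The assumption on the class of channel instances (which may depend on the system):
(i) the directional cosines stay in the direction sets; (ii) the total power and the maximum
singular value of the normalized angular-domain channel are uniformly bounded in the large-system
limit. -/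
def ChannelAssumption (dp : Measure P) (Δr α : ℝ) (s : ℕ → ℕ)
    (𝒞 : ArraySystem → Set (ChannelInstance P)) : Prop :=
  (∀ᶠ S in largeSystemLimit Δr α, ∀ C ∈ 𝒞 S,
    ∀ p, C.Ωt p ∈ directionSet s S.Lt ∧ C.Ωr p ∈ directionSet s S.Lr) ∧
  ∃ B : ℝ, ∀ᶠ S in largeSystemLimit Δr α, ∀ C ∈ 𝒞 S,
    ∫⁻ p, ‖C.a p‖ₑ ^ 2 ∂dp ≤ ENNReal.ofReal B ∧
    maxSingularValue
      (((Real.sqrt (min (2 * S.Lt) (2 * S.Lr)))⁻¹ : ℝ) • angularChannel dp S C) ≤ B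

/-- The total amplitude `∫ |a(p)| dp` is finite and at most `exp (o(Lt))` in the large-system limit,
uniformly over the class. -/
def SubexponentialAmplitude (dp : Measure P) (Δr α : ℝ)
    (𝒞 : ArraySystem → Set (ChannelInstance P)) : Prop :=
  ∀ η : ℝ, 0 < η → ∀ᶠ S in largeSystemLimit Δr α, ∀ C ∈ 𝒞 S,
    ∫⁻ p, ‖C.a p‖ₑ ∂dp ≤ ENNReal.ofReal (Real.exp (η * S.Lt))

end Channel

/-- The assumption on the sets of covariance matrices: trace at most one, and the eigenvalues of
`2 Lt Sg` are uniformly bounded in the large-system limit. -/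
def CovarianceAssumption (Δr α : ℝ)
    (𝒮 : (S : ArraySystem) → Set (Matrix (Fin S.M) (Fin S.M) ℂ)) : Prop :=
  (∀ S, ∀ Sg ∈ 𝒮 S, Sg.PosSemidef ∧ Sg.trace.re ≤ 1) ∧
  ∃ B : ℝ, ∀ᶠ S in largeSystemLimit Δr α, ∀ Sg ∈ 𝒮 S, ∀ h : Sg.IsHermitian,
    ∀ i, 2 * (S.Lt : ℝ) * h.eigenvalues i ≤ B

end

/-! Since `U` is unitary, the capacity is `log det (1 + (G H)(G H)ᴴ)` with `γ Σ = H Hᴴ`. Concavity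
of `log det` bounds the change under a perturbation `D` of `G H` by `2 √N ‖D‖_F + ‖D‖_F²`, however
large `G H` is (`abs_log_det_sub_le`). As `N` is proportional to `L_r` and the eigenvalues of `Σ`
are `O(1/L_t)`, it suffices that `‖G - G̃‖_F² = o(L_t L_r)`. `M` does not enter, whence the
uniformity in `Δ_t`.

That estimate comes from counting dimensions. All visible signatures of an array of length `L` are
within `O(e^{-cL})`, in squared norm, of one subspace of dimension `(2 + δ) L + 1`
(`exists_isometry_angularSignature_approx`). At least `2 L` retained indices are grid directions in
`[-1, 1]`, so their coordinate vectors almost lie in that subspace too. The trace of its projection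
`E` is therefore almost used up by the retained indices, and only about `δ L` is left for the
others. In `G = G E + G (1 - E)`, the discarded columns of the first term carry at most `‖G‖²` times
this remainder, where `‖G‖² = O(L)`; the second term is exponentially small against the
subexponential amplitude (`sum_compl_norm_sq_le`, `frobSq_integral_mul_le`). Rows follow by passing
to `Gᴴ`, and `δ` is arbitrary.

The subspace comes from writing the entries of a signature as real powers of one point `z` on an arc
avoiding `-1`: the integer part of the exponent gives a monomial, and the fractional part is a
Laurent polynomial up to a geometric error (`exists_polynomial_norm_exp_sub_le`). -/

/-- The squared Frobenius norm. -/
noncomputable def frobSq {m n : Type*} [Fintype m] [Fintype n] (A : Matrix m n ℂ) : ℝ :=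
  ∑ i, ∑ j, ‖A i j‖ ^ 2

/-! ### Frobenius norm and trace inequalities. -/

section Frobenius

variable {l m n : Type*} [Fintype l] [Fintype m]

open scoped Matrix.Norms.L2Operator in
theorem sum_norm_mul_col_le [DecidableEq m] (A : Matrix l m ℂ) (B : Matrix m n ℂ) (j : n) :
    ∑ i, ‖(A * B) i j‖ ^ 2 ≤ ‖A‖ ^ 2 * ∑ i, ‖B i j‖ ^ 2 := by
  have := pow_le_pow_left₀ (norm_nonneg _)
    (Matrix.l2_opNorm_mulVec A (WithLp.toLp 2 (fun i => B i j))) 2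
  rw [mul_pow, EuclideanSpace.norm_sq_eq, EuclideanSpace.norm_sq_eq] at this
  exact this

variable [Fintype n]

theorem frobSq_nonneg (A : Matrix m n ℂ) : 0 ≤ frobSq A := by
  unfold frobSq; positivity

theorem frobSq_eq_trace (A : Matrix m n ℂ) : frobSq A = (A * Aᴴ).trace.re := by
  simp only [frobSq, Matrix.trace, Matrix.diag, Matrix.mul_apply, Matrix.conjTranspose_apply,
    Complex.re_sum]
  refine Finset.sum_congr rfl fun i _ => Finset.sum_congr rfl fun j _ => ?_
  rw [Complex.star_def, Complex.mul_conj, Complex.ofReal_re, Complex.normSq_eq_norm_sq]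

theorem frobSq_conjTranspose (A : Matrix m n ℂ) : frobSq Aᴴ = frobSq A := by
  simp only [frobSq, Matrix.conjTranspose_apply, norm_star]
  exact Finset.sum_comm

theorem frobSq_mul_of_isometry [DecidableEq n] (A : Matrix m n ℂ) (W : Matrix n l ℂ)
    (hW : W * Wᴴ = 1) : frobSq (A * W) = frobSq A := by
  rw [frobSq_eq_trace, frobSq_eq_trace, Matrix.conjTranspose_mul, Matrix.mul_assoc,
    ← Matrix.mul_assoc W, hW, Matrix.one_mul]

theorem norm_trace_mul_le (A : Matrix m n ℂ) (B : Matrix n m ℂ) :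
    ‖(A * B).trace‖ ≤ √(frobSq A) * √(frobSq B) := by
  have h1 : ‖(A * B).trace‖ ≤ ∑ p : m × n, ‖A p.1 p.2‖ * ‖B p.2 p.1‖ := by
    rw [Fintype.sum_prod_type]
    simp only [Matrix.trace, Matrix.diag, Matrix.mul_apply]
    refine (norm_sum_le _ _).trans (Finset.sum_le_sum fun i _ => (norm_sum_le _ _).trans
      (Finset.sum_le_sum fun j _ => (norm_mul_le _ _)))
  refine h1.trans ((Real.sum_mul_le_sqrt_mul_sqrt _ _ _).trans_eq ?_)
  rw [← frobSq_conjTranspose B]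
  simp only [frobSq, Fintype.sum_prod_type, Matrix.conjTranspose_apply, norm_star]

end Frobenius

/-! ### Perturbation of `log det (1 + A Aᴴ)`. -/

section LogDet

variable {m n : Type*} [Fintype m] [Fintype n] [DecidableEq n]

theorem Matrix.PosDef.log_det_le_trace_sub_card {Z : Matrix n n ℂ} (hZ : Z.PosDef) :
    Real.log Z.det.re ≤ Z.trace.re - Fintype.card n := by
  have hd : Z.det.re = ∏ i, hZ.1.eigenvalues i := by
    rw [hZ.1.det_eq_prod_eigenvalues]
    exact (congrArg Complex.re (Complex.ofReal_prod _ _).symm).trans (Complex.ofReal_re _)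
  have ht : Z.trace.re = ∑ i, hZ.1.eigenvalues i := by
    rw [hZ.1.trace_eq_sum_eigenvalues]
    exact (congrArg Complex.re (Complex.ofReal_sum _ _).symm).trans (Complex.ofReal_re _)
  rw [hd, ht, Real.log_prod fun i _ => (hZ.eigenvalues_pos i).ne', Fintype.card_eq_sum_ones]
  push_cast
  rw [← Finset.sum_sub_distrib]
  exact Finset.sum_le_sum fun i _ => Real.log_le_sub_one_of_pos (hZ.eigenvalues_pos i)

theorem Matrix.PosDef.det_re_pos {Z : Matrix n n ℂ} (hZ : Z.PosDef) : 0 < Z.det.re :=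
  (Complex.pos_iff.1 hZ.det_pos).1

theorem Matrix.PosDef.det_eq_re {Z : Matrix n n ℂ} (hZ : Z.PosDef) : Z.det = (Z.det.re : ℂ) := by
  apply Complex.ext
  · simp
  · simpa using (Complex.pos_iff.1 hZ.det_pos).2.symm

/-- Concavity: `log det` lies below its tangent at `X`. A congruence by a factor `K` of `X = Kᴴ K`
reduces to `X = 1`, where it is `log t ≤ t - 1` on eigenvalues. -/
theorem log_det_sub_log_det_le_trace {X Y : Matrix n n ℂ} (hX : X.PosDef) (hY : Y.PosDef) :
    Real.log Y.det.re - Real.log X.det.re ≤ (X⁻¹ * (Y - X)).trace.re := by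
  have hXu : IsUnit X.det := hX.isUnit.map Matrix.detMonoidHom
  obtain ⟨K, hK⟩ : ∃ K : Matrix n n ℂ, X = Kᴴ * K := by
    open scoped MatrixOrder in
    exact CStarAlgebra.nonneg_iff_eq_star_mul_self.1 hX.posSemidef.nonneg
  have hKu : IsUnit K.det := by
    rw [hK, Matrix.det_mul] at hXu
    exact isUnit_of_mul_isUnit_right hXu
  have hKu' : IsUnit (Kᴴ).det := by
    rw [hK, Matrix.det_mul] at hXu
    exact isUnit_of_mul_isUnit_left hXu
  set Z := (K⁻¹)ᴴ * Y * K⁻¹ with hZdef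
  have hZ : Z.PosDef := by
    apply hY.conjTranspose_mul_mul_same
    apply Matrix.mulVec_injective_of_isUnit
    rw [Matrix.isUnit_nonsing_inv_iff, Matrix.isUnit_iff_isUnit_det]
    exact hKu
  have hY' : Y = Kᴴ * Z * K := by
    rw [hZdef, Matrix.conjTranspose_nonsing_inv, Matrix.mul_assoc, Matrix.mul_assoc,
      Matrix.mul_assoc, Matrix.nonsing_inv_mul _ hKu, Matrix.mul_one, ← Matrix.mul_assoc,
      Matrix.mul_nonsing_inv _ hKu', Matrix.one_mul]
  have hdet : Y.det.re = X.det.re * Z.det.re := by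
    have : Y.det = X.det * Z.det := by
      rw [hY', hK]; simp only [Matrix.det_mul]; ring
    rw [this, hX.det_eq_re, hZ.det_eq_re]; norm_cast
  have htr : (X⁻¹ * (Y - X)).trace = Z.trace - Fintype.card n := by
    rw [Matrix.mul_sub, Matrix.nonsing_inv_mul _ hXu, Matrix.trace_sub, Matrix.trace_one, hK,
      Matrix.mul_inv_rev, hZdef, Matrix.conjTranspose_nonsing_inv, Matrix.mul_assoc,
      Matrix.trace_mul_comm]
  rw [hdet, Real.log_mul hX.det_re_pos.ne' hZ.det_re_pos.ne', htr]
  have := hZ.log_det_le_trace_sub_card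
  simp only [Complex.sub_re, Complex.natCast_re]
  linarith

theorem posDef_one_add_mul_conjTranspose (A : Matrix n m ℂ) : (1 + A * Aᴴ).PosDef :=
  Matrix.PosDef.one.add_posSemidef (Matrix.posSemidef_self_mul_conjTranspose A)

/-- With `P = A Aᴴ` and `X = 1 + P`, the difference equals `X⁻¹ (P + P²) X⁻¹`. -/
theorem posSemidef_one_sub_inv (A : Matrix n m ℂ) : (1 - (1 + A * Aᴴ)⁻¹).PosSemidef := by
  set X := 1 + A * Aᴴ with hX
  have hXp : X.PosDef := posDef_one_add_mul_conjTranspose A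
  have hXu : IsUnit X.det := hXp.isUnit.map Matrix.detMonoidHom
  have hP := Matrix.posSemidef_self_mul_conjTranspose A
  have h2 : (A * Aᴴ + A * Aᴴ * (A * Aᴴ)).PosSemidef := by
    refine hP.add ?_
    have := Matrix.posSemidef_self_mul_conjTranspose (A * Aᴴ)
    simpa [Matrix.conjTranspose_mul] using this
  have h3 := h2.conjTranspose_mul_mul_same X⁻¹
  rw [hXp.inv.1] at h3
  have h4 : A * Aᴴ + A * Aᴴ * (A * Aᴴ) = (X - 1) * X := by
    rw [hX]; noncomm_ring
  have h5 : X⁻¹ * ((X - 1) * X) * X⁻¹ = 1 - X⁻¹ := by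
    rw [← Matrix.mul_assoc, Matrix.mul_assoc _ X, Matrix.mul_nonsing_inv _ hXu, Matrix.mul_one,
      Matrix.mul_sub, Matrix.nonsing_inv_mul _ hXu, Matrix.mul_one]
  rwa [h4, h5] at h3

/-- The Gram matrix is `X⁻¹ - X⁻²`, dominated by the identity. The bound does not depend on the size
of `A`, which makes the perturbation estimate uniform. -/
theorem frobSq_inv_mul_le (A : Matrix n m ℂ) :
    frobSq ((1 + A * Aᴴ)⁻¹ * A) ≤ Fintype.card n := by
  set X := 1 + A * Aᴴ with hX
  have hXp : X.PosDef := posDef_one_add_mul_conjTranspose A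
  have hXu : IsUnit X.det := hXp.isUnit.map Matrix.detMonoidHom
  have h1 : X⁻¹ * A * (X⁻¹ * A)ᴴ = X⁻¹ - X⁻¹ * X⁻¹ᴴ := by
    rw [Matrix.conjTranspose_mul, hXp.inv.1, Matrix.mul_assoc, ← Matrix.mul_assoc A,
      show A * Aᴴ = X - 1 by rw [hX]; abel, Matrix.sub_mul, Matrix.mul_nonsing_inv _ hXu,
      Matrix.mul_sub, Matrix.mul_one, Matrix.one_mul]
  have h2 := (posSemidef_one_sub_inv A).trace_nonneg
  rw [← hX, Matrix.trace_sub, Matrix.trace_one] at h2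
  have h3 := (Complex.le_def.1 h2).1
  have h4 := frobSq_nonneg X⁻¹
  rw [frobSq_eq_trace] at h4 ⊢
  rw [h1, Matrix.trace_sub, Complex.sub_re]
  simp at h3
  linarith

theorem trace_inv_mul_le_frobSq (A D : Matrix n m ℂ) :
    ((1 + A * Aᴴ)⁻¹ * (D * Dᴴ)).trace.re ≤ frobSq D := by
  have h := ((posSemidef_one_sub_inv A).conjTranspose_mul_mul_same D).trace_nonneg
  have h3 := (Complex.le_def.1 h).1
  rw [Matrix.mul_assoc, Matrix.trace_mul_comm, Matrix.mul_assoc, Matrix.sub_mul, Matrix.one_mul,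
    Matrix.trace_sub, Complex.sub_re, ← frobSq_eq_trace] at h3
  simpa using h3

/-- For `B = A + D` the tangent bound contains two cross terms, controlled by Cauchy–Schwarz against
`X⁻¹ A`, and the term `D Dᴴ`, controlled by `X⁻¹ ≤ 1`. -/
theorem log_det_sub_le (A B : Matrix n m ℂ) :
    Real.log (1 + B * Bᴴ).det.re - Real.log (1 + A * Aᴴ).det.re ≤
      2 * (√(Fintype.card n) * √(frobSq (B - A))) + frobSq (B - A) := by
  refine (log_det_sub_log_det_le_trace (posDef_one_add_mul_conjTranspose A)
    (posDef_one_add_mul_conjTranspose B)).trans ?_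
  set D := B - A with hD
  have hB : B = A + D := by rw [hD]; abel
  have hXp := posDef_one_add_mul_conjTranspose A
  have h4 := frobSq_inv_mul_le A
  have h5 := trace_inv_mul_le_frobSq A D
  set X := 1 + A * Aᴴ with hX
  have h1 : 1 + B * Bᴴ - X = A * Dᴴ + D * Aᴴ + D * Dᴴ := by
    rw [hB, hX, Matrix.conjTranspose_add, Matrix.mul_add, Matrix.add_mul, Matrix.add_mul]; abel
  have h2 : (X⁻¹ * (A * Dᴴ)).trace.re ≤ √(Fintype.card n) * √(frobSq D) := by
    rw [← Matrix.mul_assoc]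
    refine (Complex.re_le_norm _).trans ((norm_trace_mul_le _ _).trans ?_)
    rw [frobSq_conjTranspose]
    gcongr
  have h3 : (X⁻¹ * (D * Aᴴ)).trace.re ≤ √(Fintype.card n) * √(frobSq D) := by
    rw [← Matrix.mul_assoc, Matrix.trace_mul_comm, ← Matrix.mul_assoc]
    refine (Complex.re_le_norm _).trans ((norm_trace_mul_le _ _).trans ?_)
    rw [← frobSq_conjTranspose, Matrix.conjTranspose_mul, hXp.inv.1,
      Matrix.conjTranspose_conjTranspose]
    gcongr
  rw [h1, Matrix.mul_add, Matrix.mul_add, Matrix.trace_add, Matrix.trace_add, Complex.add_re,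
    Complex.add_re]
  linarith

theorem abs_log_det_sub_le (A B : Matrix n m ℂ) :
    |Real.log (1 + A * Aᴴ).det.re - Real.log (1 + B * Bᴴ).det.re| ≤
      2 * (√(Fintype.card n) * √(frobSq (A - B))) + frobSq (A - B) := by
  have h : frobSq (B - A) = frobSq (A - B) := by
    unfold frobSq
    simp only [Matrix.sub_apply]
    exact Finset.sum_congr rfl fun i _ => Finset.sum_congr rfl fun j _ => by rw [norm_sub_rev]
  have h1 := log_det_sub_le A B
  have h2 := log_det_sub_le B A
  rw [h] at h1
  exact abs_sub_le_iff.2 ⟨h2, h1⟩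

/-- Take `H = W diag(√(γ λ_i))` from the spectral theorem: `W` preserves the Frobenius norm and the
diagonal scales each column. -/
theorem Matrix.PosSemidef.exists_mul_conjTranspose_frobSq_le {Q : Matrix n n ℂ}
    (hQ : Q.PosSemidef) {γ c : ℝ} (hγ : 0 ≤ γ) (hc : ∀ i, hQ.1.eigenvalues i ≤ c) :
    ∃ H : Matrix n n ℂ, (γ : ℂ) • Q = H * Hᴴ ∧
      ∀ X : Matrix m n ℂ, frobSq (X * H) ≤ γ * c * frobSq X := by
  set W : Matrix n n ℂ := (hQ.1.eigenvectorUnitary : Matrix n n ℂ) with hW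
  have hWu : W * Wᴴ = 1 := Matrix.mem_unitaryGroup_iff.1 hQ.1.eigenvectorUnitary.2
  set d : n → ℂ := fun i => ((√(γ * hQ.1.eigenvalues i) : ℝ) : ℂ) with hd
  have hnn : ∀ i, 0 ≤ γ * hQ.1.eigenvalues i := fun i => mul_nonneg hγ (hQ.eigenvalues_nonneg i)
  have hspec : Q = W * Matrix.diagonal (RCLike.ofReal ∘ hQ.1.eigenvalues) * Wᴴ := by
    have := hQ.1.spectral_theorem
    rwa [Unitary.conjStarAlgAut_apply] at this
  refine ⟨W * Matrix.diagonal d, ?_, fun X => ?_⟩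
  · rw [Matrix.conjTranspose_mul, Matrix.diagonal_conjTranspose, Matrix.mul_assoc,
      ← Matrix.mul_assoc (Matrix.diagonal d), Matrix.diagonal_mul_diagonal]
    conv_lhs => rw [hspec]
    rw [← Matrix.smul_mul, ← Matrix.mul_smul, ← Matrix.diagonal_smul, Matrix.mul_assoc]
    congr 3
    ext i
    simp only [Pi.smul_apply, Function.comp, smul_eq_mul, hd, Pi.star_apply, Complex.star_def,
      Complex.conj_ofReal]
    rw [← Complex.ofReal_mul, Real.mul_self_sqrt (hnn i), Complex.ofReal_mul]
    rfl
  · rw [← Matrix.mul_assoc, ← frobSq_mul_of_isometry X W hWu]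
    simp only [frobSq, Finset.mul_sum, Matrix.mul_diagonal]
    refine Finset.sum_le_sum fun i _ => Finset.sum_le_sum fun j _ => ?_
    rw [norm_mul, mul_pow, mul_comm]
    gcongr
    rw [hd, Complex.norm_real, Real.norm_of_nonneg (Real.sqrt_nonneg _), Real.sq_sqrt (hnn j)]
    exact mul_le_mul_of_nonneg_left (hc j) hγ

end LogDet

/-! ### Laurent polynomial approximation of fractional powers on an arc. -/

/-- Induction on `(k + 1) choose(a, k + 1) = (a - k) choose(a, k)` with `|a - k| ≤ k + 1`. -/
theorem norm_choose_le_one {a : ℂ} (ha : ‖a‖ ≤ 1) (k : ℕ) : ‖Ring.choose a k‖ ≤ 1 := by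
  induction k with
  | zero => simp
  | succ k ih =>
    have h1 : ((k : ℂ) + 1) * Ring.choose a (k + 1) = Ring.choose a k * (a - k) := by
      have h2 := Ring.descPochhammer_eq_factorial_smul_choose a (k + 1)
      have h3 := Ring.descPochhammer_eq_factorial_smul_choose a k
      rw [descPochhammer_succ_right, Polynomial.smeval_mul, h3] at h2
      simp only [Polynomial.smeval_sub, Polynomial.smeval_X, Polynomial.smeval_natCast, pow_one,
        pow_zero, nsmul_eq_mul, mul_one, Nat.factorial_succ, Nat.cast_mul, Nat.cast_add,
        Nat.cast_one] at h2
      have h4 : ((k.factorial : ℕ) : ℂ) ≠ 0 := by exact_mod_cast k.factorial_ne_zero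
      apply mul_left_cancel₀ h4
      linear_combination -h2
    have h5 : ((k : ℝ) + 1) * ‖Ring.choose a (k + 1)‖ ≤ (k : ℝ) + 1 := by
      have h6 : ‖(k : ℂ) + 1‖ = (k : ℝ) + 1 := by
        rw [← Nat.cast_one, ← Nat.cast_add, Complex.norm_natCast]; push_cast; ring
      rw [← h6, ← norm_mul, h1, norm_mul, h6]
      have h7 : ‖a - k‖ ≤ (k : ℝ) + 1 := by
        refine (norm_sub_le _ _).trans ?_
        rw [Complex.norm_natCast]; linarith
      nlinarith [norm_nonneg (a - k), norm_nonneg (Ring.choose a k)]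
    have h8 : (0 : ℝ) < (k : ℝ) + 1 := by positivity
    nlinarith

theorem norm_one_sub_cpow_sub_le {a w : ℂ} {ρ : ℝ} (ha : ‖a‖ ≤ 1) (hw : ‖w‖ ≤ ρ) (hρ : ρ < 1)
    (D : ℕ) :
    ‖(∑ k ∈ Finset.range D, Ring.choose a k * (-w) ^ k) - (1 - w) ^ a‖ ≤ 1 * ρ ^ D / (1 - ρ) := by
  refine norm_sub_le_of_geometric_bound_of_hasSum hρ (fun k => ?_) ?_ D
  · rw [norm_mul, norm_pow, norm_neg]
    have := norm_choose_le_one ha k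
    gcongr
  · have h := (Complex.one_add_cpow_hasFPowerSeriesOnBall_zero (a := a)).hasSum (y := -w) (by
      rw [← ENNReal.ofReal_one, Metric.eball_ofReal]
      simpa using hw.trans_lt hρ)
    simpa [binomialSeries, FormalMultilinearSeries.coeff_ofScalars, mul_comm, sub_eq_add_neg]
      using h

theorem norm_sum_choose_le {a w : ℂ} {ρ : ℝ} (ha : ‖a‖ ≤ 1) (hw : ‖w‖ ≤ ρ) (hρ : ρ < 1)
    (D : ℕ) : ‖∑ k ∈ Finset.range D, Ring.choose a k * (-w) ^ k‖ ≤ 1 / (1 - ρ) := by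
  have h0 : 0 ≤ ρ := (norm_nonneg w).trans hw
  calc _ ≤ ∑ k ∈ Finset.range D, ρ ^ k := by
        refine (norm_sum_le _ _).trans (Finset.sum_le_sum fun k _ => ?_)
        rw [norm_mul, norm_pow, norm_neg]
        have := norm_choose_le_one ha k
        calc _ ≤ 1 * ρ ^ k := by gcongr
          _ = _ := one_mul _
    _ ≤ ∑' k, ρ ^ k := (summable_geometric_of_lt_one h0 hρ).sum_le_tsum _
        fun k _ => pow_nonneg h0 k
    _ = _ := by rw [tsum_geometric_of_lt_one h0 hρ, one_div]

theorem norm_one_sub_cpow_le {a w : ℂ} {ρ : ℝ} (ha : ‖a‖ ≤ 1) (hw : ‖w‖ ≤ ρ) (hρ : ρ < 1) :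
    ‖(1 - w) ^ a‖ ≤ 1 / (1 - ρ) := by
  simpa using norm_one_sub_cpow_sub_le ha hw hρ 0

/-- The base is `(1 + e^{iθ}) / 2 = cos(θ/2) e^{iθ/2}`; on this range the cosine is positive and the
principal logarithm is the obvious one. -/
theorem one_sub_half_one_sub_exp_cpow {θ : ℝ} (h1 : -Real.pi < θ) (h2 : θ < Real.pi) (a : ℂ) :
    (1 - (1 - Complex.exp (θ * Complex.I)) / 2) ^ a =
      Complex.exp ((Real.log (Real.cos (θ / 2)) + (θ / 2 : ℝ) * Complex.I) * a) := by
  have hc : 0 < Real.cos (θ / 2) := Real.cos_pos_of_mem_Ioo ⟨by linarith, by linarith⟩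
  have e1 : 1 - (1 - Complex.exp (θ * Complex.I)) / 2 =
      ((Real.cos (θ / 2) : ℝ) : ℂ) * Complex.exp ((θ / 2 : ℝ) * Complex.I) := by
    rw [Complex.ofReal_cos, Complex.cos]
    have e2 : Complex.exp (θ * Complex.I) =
        Complex.exp ((θ / 2 : ℝ) * Complex.I) * Complex.exp ((θ / 2 : ℝ) * Complex.I) := by
      rw [← Complex.exp_add]; congr 1; push_cast; ring
    have e3 : Complex.exp (-((θ / 2 : ℝ) : ℂ) * Complex.I) *
        Complex.exp ((θ / 2 : ℝ) * Complex.I) = 1 := by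
      rw [← Complex.exp_add]; simp
    rw [e2]
    linear_combination (-1 / 2 : ℂ) * e3
  rw [e1, Complex.cpow_def_of_ne_zero (mul_ne_zero (by exact_mod_cast hc.ne')
    (Complex.exp_ne_zero _)), Complex.log_ofReal_mul hc (Complex.exp_ne_zero _),
    Complex.log_exp (by simp; linarith) (by simp; linarith)]

theorem norm_half_one_sub_exp (θ : ℝ) :
    ‖(1 - Complex.exp (θ * Complex.I)) / 2‖ = |Real.sin (θ / 2)| := by
  have e1 : (1 - Complex.exp (θ * Complex.I)) / 2 =
      -Complex.I * ((Real.sin (θ / 2) : ℝ) : ℂ) * Complex.exp ((θ / 2 : ℝ) * Complex.I) := by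
    rw [Complex.ofReal_sin, Complex.sin]
    have e2 : Complex.exp (θ * Complex.I) =
        Complex.exp ((θ / 2 : ℝ) * Complex.I) * Complex.exp ((θ / 2 : ℝ) * Complex.I) := by
      rw [← Complex.exp_add]; congr 1; push_cast; ring
    have e3 : Complex.exp (-((θ / 2 : ℝ) : ℂ) * Complex.I) *
        Complex.exp ((θ / 2 : ℝ) * Complex.I) = 1 := by
      rw [← Complex.exp_add]; simp
    rw [e2]
    linear_combination (-1 / 2 : ℂ) * e3 + (1 / 2 : ℂ) *
      (Complex.exp (-((θ / 2 : ℝ) : ℂ) * Complex.I) * Complex.exp ((θ / 2 : ℝ) * Complex.I) -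
        Complex.exp ((θ / 2 : ℝ) * Complex.I) ^ 2) * Complex.I_sq
  rw [e1]
  simp [Complex.norm_exp_ofReal_mul_I, -Complex.ofReal_sin, -Complex.ofReal_div]

open Polynomial in
/-- On an arc of the unit circle that avoids `-1`, the power `z ^ y` is approximated by Laurent
polynomials of degree `D` with an error that decays geometrically in `D`. -/
theorem exists_polynomial_norm_exp_sub_le {θ₀ : ℝ} (h0 : 0 < θ₀) (h1 : θ₀ < Real.pi) :
    ∃ ρ : ℝ, 0 < ρ ∧ ρ < 1 ∧ ∀ y : ℝ, 0 ≤ y → y ≤ 1 → ∀ D : ℕ, ∃ Q : ℂ[X], Q.natDegree ≤ 2 * D ∧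
      ∀ θ : ℝ, |θ| ≤ θ₀ → ‖Complex.exp (y * θ * Complex.I) -
        Complex.exp (θ * Complex.I) ^ (-(D : ℤ)) * Q.eval (Complex.exp (θ * Complex.I))‖ ≤
        2 * ρ ^ D / (1 - ρ) ^ 2 := by
  have hρ0 : 0 < Real.sin (θ₀ / 2) := Real.sin_pos_of_pos_of_lt_pi (by linarith) (by linarith)
  have hρ1 : Real.sin (θ₀ / 2) < 1 := by
    rw [← Real.sin_pi_div_two]
    exact Real.sin_lt_sin_of_lt_of_le_pi_div_two (by linarith) le_rfl (by linarith)
  refine ⟨Real.sin (θ₀ / 2), hρ0, hρ1, fun y hy0 hy1 D => ?_⟩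
  set ρ := Real.sin (θ₀ / 2) with hρ
  have hya : ‖(y : ℂ)‖ ≤ 1 := by rw [Complex.norm_real, Real.norm_of_nonneg hy0]; exact hy1
  have hyb : ‖(-y : ℂ)‖ ≤ 1 := by rwa [norm_neg]
  -- Truncated binomial series of `((1 + z)/2)^y` and `((1 + z⁻¹)/2)^(-y)`. The second is multiplied
  -- by `z^D` to clear negative powers, using `(z⁻¹ - 1)/2 = z⁻¹ (1 - z)/2`.
  refine ⟨(∑ k ∈ Finset.range D, C (Ring.choose (y : ℂ) k) * (C (1 / 2) * (X - 1)) ^ k) *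
    (∑ k ∈ Finset.range D, C (Ring.choose (-y : ℂ) k) * (C (1 / 2) * (1 - X)) ^ k * X ^ (D - k)),
    ?_, fun θ hθ => ?_⟩
  · rw [two_mul]
    refine natDegree_mul_le_of_le (natDegree_sum_le_of_forall_le _ _ fun k hk => ?_)
      (natDegree_sum_le_of_forall_le _ _ fun k hk => ?_)
    · have : k ≤ D := (Finset.mem_range.1 hk).le
      refine le_trans ?_ this
      compute_degree
    · have : k ≤ D := (Finset.mem_range.1 hk).le
      calc _ ≤ k + (D - k) := by compute_degree
        _ = D := by omega
  · obtain ⟨hθ1, hθ2⟩ := abs_le.1 hθ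
    set z := Complex.exp (θ * Complex.I) with hz
    have hz0 : z ≠ 0 := Complex.exp_ne_zero _
    have hzi : Complex.exp ((-θ : ℝ) * Complex.I) = z⁻¹ := by
      rw [hz, ← Complex.exp_neg]; congr 1; push_cast; ring
    set w := (1 - z) / 2 with hw
    set w' := (1 - z⁻¹) / 2 with hw'
    have hs : |Real.sin (θ / 2)| ≤ ρ := by
      rw [abs_le, hρ, ← Real.sin_neg]
      constructor <;> apply Real.sin_le_sin_of_le_of_le_pi_div_two <;> linarith
    have hwn : ‖w‖ ≤ ρ := by rw [hw, hz, norm_half_one_sub_exp]; exact hs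
    have hwn' : ‖w'‖ ≤ ρ := by
      rw [hw', ← hzi, norm_half_one_sub_exp, neg_div, Real.sin_neg, abs_neg]; exact hs
    -- The two bases have the same modulus `cos(θ/2)`, which cancels, and opposite arguments `±θ/2`.
    have hprod : Complex.exp (y * θ * Complex.I) = (1 - w) ^ (y : ℂ) * (1 - w') ^ (-y : ℂ) := by
      rw [hw, hw', ← hzi, hz, one_sub_half_one_sub_exp_cpow (by linarith) (by linarith),
        one_sub_half_one_sub_exp_cpow (by linarith) (by linarith), ← Complex.exp_add, neg_div,
        Real.cos_neg]
      congr 1; push_cast; ring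
    have heval : z ^ (-(D : ℤ)) * ((∑ k ∈ Finset.range D,
          C (Ring.choose (y : ℂ) k) * (C (1 / 2) * (X - 1)) ^ k) * (∑ k ∈ Finset.range D,
          C (Ring.choose (-y : ℂ) k) * (C (1 / 2) * (1 - X)) ^ k * X ^ (D - k))).eval z =
        (∑ k ∈ Finset.range D, Ring.choose (y : ℂ) k * (-w) ^ k) *
        (∑ k ∈ Finset.range D, Ring.choose (-y : ℂ) k * (-w') ^ k) := by
      rw [eval_mul, eval_finsetSum, eval_finsetSum, mul_left_comm]
      congr 1
      · refine Finset.sum_congr rfl fun k _ => ?_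
        simp only [eval_mul, eval_C, eval_pow, eval_sub, eval_X, eval_one, hw]
        congr 2; ring
      · rw [Finset.mul_sum]
        refine Finset.sum_congr rfl fun k hk => ?_
        have hkD : k ≤ D := (Finset.mem_range.1 hk).le
        simp only [eval_mul, eval_C, eval_pow, eval_sub, eval_X, eval_one, hw']
        have e1 : -((1 - z⁻¹) / 2) = (1 / 2 * (1 - z)) * z⁻¹ := by field_simp; ring
        have e2 : z ^ D = z ^ (D - k) * z ^ k := by rw [← pow_add]; congr 1; omega
        rw [e1, mul_pow _ z⁻¹, inv_pow, zpow_neg, zpow_natCast, e2]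
        field_simp
    rw [heval, hprod]
    have hb1 := norm_one_sub_cpow_sub_le hya hwn hρ1 D
    have hb2 := norm_one_sub_cpow_sub_le hyb hwn' hρ1 D
    have hb3 := norm_one_sub_cpow_le hyb hwn' hρ1
    have hb4 := norm_sum_choose_le hya hwn hρ1 D
    set p := ∑ k ∈ Finset.range D, Ring.choose (y : ℂ) k * (-w) ^ k
    set r := ∑ k ∈ Finset.range D, Ring.choose (-y : ℂ) k * (-w') ^ k
    set A := (1 - w) ^ (y : ℂ)
    set B := (1 - w') ^ (-y : ℂ)
    have hpos : 0 < 1 - ρ := by linarith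
    calc ‖A * B - p * r‖ = ‖-((p - A) * B) - p * (r - B)‖ := by congr 1; ring
      _ ≤ ‖p - A‖ * ‖B‖ + ‖p‖ * ‖r - B‖ := by
        refine (norm_sub_le _ _).trans ?_
        rw [norm_neg, norm_mul, norm_mul]
      _ ≤ (1 * ρ ^ D / (1 - ρ)) * (1 / (1 - ρ)) + (1 / (1 - ρ)) * (1 * ρ ^ D / (1 - ρ)) := by
        gcongr
      _ = _ := by field_simp; ring

/-! ### Orthogonal projections written as `V Vᴴ`. -/

section Isometry

variable {l m n k : Type*} [Fintype l] [Fintype m] [Fintype n] [Fintype k]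
  [DecidableEq k]

theorem frobSq_sub_mul_add_frobSq_mul (V : Matrix n k ℂ) (hV : Vᴴ * V = 1) (A : Matrix n m ℂ) :
    frobSq (A - V * Vᴴ * A) + frobSq (Vᴴ * A) = frobSq A := by
  rw [← frobSq_conjTranspose (A - _), ← frobSq_conjTranspose (Vᴴ * A), ← frobSq_conjTranspose A,
    frobSq_eq_trace, frobSq_eq_trace, frobSq_eq_trace, ← Complex.add_re, ← Matrix.trace_add]
  congr 2
  have h : V * Vᴴ * (V * Vᴴ) = V * Vᴴ := by
    rw [Matrix.mul_assoc, ← Matrix.mul_assoc Vᴴ, hV, Matrix.one_mul]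
  simp only [Matrix.conjTranspose_sub, Matrix.conjTranspose_mul, Matrix.conjTranspose_conjTranspose,
    Matrix.sub_mul, Matrix.mul_sub]
  have h2 : Aᴴ * (V * Vᴴ) * (V * Vᴴ * A) = Aᴴ * (V * Vᴴ) * A := by
    rw [Matrix.mul_assoc, ← Matrix.mul_assoc (V * Vᴴ), h]
    simp only [Matrix.mul_assoc]
  rw [h2]
  simp only [Matrix.mul_assoc]
  abel

/-- Orthogonal projection is the best approximation: Pythagoras applied to `A - V B`, which has the
same residual as `A`. -/
theorem frobSq_sub_mul_le (V : Matrix n k ℂ) (hV : Vᴴ * V = 1) (A : Matrix n m ℂ)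
    (B : Matrix k m ℂ) : frobSq (A - V * Vᴴ * A) ≤ frobSq (A - V * B) := by
  have h := frobSq_sub_mul_add_frobSq_mul V hV (A - V * B)
  have h2 : A - V * B - V * Vᴴ * (A - V * B) = A - V * Vᴴ * A := by
    rw [Matrix.mul_sub, Matrix.mul_assoc V Vᴴ (V * B), ← Matrix.mul_assoc Vᴴ, hV, Matrix.one_mul]
    abel
  rw [h2] at h
  linarith [frobSq_nonneg (Vᴴ * (A - V * B))]

end Isometry

theorem exists_isometry_mul_eq {n J : ℕ} (A : Matrix (Fin n) (Fin J) ℂ) :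
    ∃ (K : ℕ) (V : Matrix (Fin n) (Fin K) ℂ) (R : Matrix (Fin K) (Fin J) ℂ),
      K ≤ J ∧ Vᴴ * V = 1 ∧ A = V * R := by
  set c : Fin J → EuclideanSpace ℂ (Fin n) := fun j => WithLp.toLp 2 fun i => A i j with hc
  set W := Submodule.span ℂ (Set.range c) with hW
  set b := stdOrthonormalBasis ℂ W with hb
  refine ⟨Module.finrank ℂ W, Matrix.of fun i j => (b j : EuclideanSpace ℂ (Fin n)) i,
    Matrix.of fun j k => b.repr ⟨c k, Submodule.subset_span ⟨k, rfl⟩⟩ j, ?_, ?_, ?_⟩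
  · exact (finrank_range_le_card (R := ℂ) c).trans_eq (Fintype.card_fin J)
  · ext i j
    have h := orthonormal_iff_ite.1 b.orthonormal i j
    rw [Submodule.coe_inner, PiLp.inner_apply] at h
    rw [Matrix.one_apply, ← h, Matrix.mul_apply]
    refine Finset.sum_congr rfl fun x _ => ?_
    simp [Matrix.conjTranspose_apply, mul_comm]
  · ext i j
    have h := b.sum_repr ⟨c j, Submodule.subset_span ⟨j, rfl⟩⟩
    have h2 := congrArg (fun x : W => (x : EuclideanSpace ℂ (Fin n)) i) h
    simp only [Submodule.coe_sum, Submodule.coe_smul, WithLp.ofLp_sum, Finset.sum_apply,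
      PiLp.smul_apply, smul_eq_mul] at h2
    rw [Matrix.mul_apply]
    simp only [Matrix.of_apply]
    rw [show A i j = (c j) i from rfl, ← h2]
    exact Finset.sum_congr rfl fun x _ => mul_comm _ _

/-! ### Signatures, the DFT basis, and the low-dimensional subspace. -/

section Signature

theorem star_signature (n : ℕ) (Δ Ω : ℝ) (i : Fin n) :
    star (signature n Δ Ω i) = ((1 / √n : ℝ) : ℂ) *
      Complex.exp (2 * Real.pi * Complex.I * ((i : ℕ) : ℂ) * Δ * Ω) := by
  rw [signature, star_mul', Complex.star_def, Complex.conj_ofReal,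
    ← Complex.exp_conj]
  simp [Complex.conj_ofNat]

theorem ofReal_one_div_sqrt_mul_self (n : ℕ) :
    ((1 / √n : ℝ) : ℂ) * ((1 / √n : ℝ) : ℂ) = 1 / n := by
  rw [← Complex.ofReal_mul, div_mul_div_comm, Real.mul_self_sqrt n.cast_nonneg]
  push_cast; ring

theorem star_signature_mul (n : ℕ) (Δ Ω Ω' : ℝ) (i : Fin n) :
    star (signature n Δ Ω i) * signature n Δ Ω' i =
      1 / n * Complex.exp (2 * Real.pi * Complex.I * ((i : ℕ) : ℂ) * Δ * (Ω - Ω')) := by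
  rw [star_signature, signature, mul_mul_mul_comm, ofReal_one_div_sqrt_mul_self, ← Complex.exp_add]
  congr 2; ring

/-- The spatial signature in the angular domain. -/
noncomputable def angularSignature (n : ℕ) (Δ Ω : ℝ) : Fin n → ℂ := fun m =>
  beam n Δ (Ω - ((m : ℕ) : ℝ) / (n * Δ))

theorem angularSignature_eq (n : ℕ) (Δ Ω : ℝ) :
    angularSignature n Δ Ω = (dft n Δ)ᴴ *ᵥ signature n Δ Ω := by
  funext m
  simp only [angularSignature, beam, dotProduct, Matrix.mulVec, Pi.star_apply,
    Matrix.conjTranspose_apply, dft, Matrix.of_apply]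
  refine Finset.sum_congr rfl fun i _ => ?_
  rw [star_signature_mul, star_signature_mul]
  congr 2; push_cast; ring

theorem continuous_beam (n : ℕ) (Δ : ℝ) : Continuous (beam n Δ) := by
  unfold beam dotProduct signature
  simp only [Pi.star_apply]
  fun_prop

theorem dft_conjTranspose_mul_self {n : ℕ} {Δ : ℝ} (hn : 0 < n) (hΔ : 0 < Δ) :
    (dft n Δ)ᴴ * dft n Δ = 1 := by
  have hn' : (n : ℂ) ≠ 0 := by exact_mod_cast hn.ne'
  have hΔ' : (Δ : ℂ) ≠ 0 := by exact_mod_cast hΔ.ne'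
  ext j k
  have hterm : ∀ i : Fin n, (dft n Δ)ᴴ j i * dft n Δ i k = 1 / n *
      (Complex.exp (2 * Real.pi * Complex.I / n) ^ (((j : ℕ) : ℤ) - ((k : ℕ) : ℤ))) ^ (i : ℕ) := by
    intro i
    rw [Matrix.conjTranspose_apply, dft, Matrix.of_apply, Matrix.of_apply, star_signature_mul,
      ← Complex.exp_int_mul, ← Complex.exp_nat_mul]
    congr 2; push_cast; field_simp
  rw [Matrix.mul_apply, Finset.sum_congr rfl fun i _ => hterm i, ← Finset.mul_sum,
    Fin.sum_univ_eq_sum_range (fun i => (Complex.exp (2 * Real.pi * Complex.I / n) ^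
      (((j : ℕ) : ℤ) - ((k : ℕ) : ℤ))) ^ i) n]
  have hp := Complex.isPrimitiveRoot_exp n hn.ne'
  by_cases hjk : j = k
  · subst hjk
    simp [hn']
  · rw [Matrix.one_apply_ne hjk, geom_sum_eq, ← zpow_natCast, ← zpow_mul, mul_comm _ (n : ℤ),
      zpow_mul, zpow_natCast, hp.pow_eq_one]
    · simp
    · intro h
      rw [hp.zpow_eq_one_iff_dvd] at h
      apply hjk
      have h2 : ((j : ℕ) : ℤ) ≡ ((k : ℕ) : ℤ) [ZMOD n] := (Int.modEq_iff_dvd.2 h).symm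
      rw [Int.natCast_modEq_iff] at h2
      exact Fin.ext (Nat.ModEq.eq_of_lt_of_lt h2 j.2 k.2)

theorem dft_mul_conjTranspose_self {n : ℕ} {Δ : ℝ} (hn : 0 < n) (hΔ : 0 < Δ) :
    dft n Δ * (dft n Δ)ᴴ = 1 :=
  mul_eq_one_comm.1 (dft_conjTranspose_mul_self hn hΔ)

theorem angularSignature_grid {n : ℕ} {Δ : ℝ} (hn : 0 < n) (hΔ : 0 < Δ) (m i : Fin n) :
    angularSignature n Δ (((m : ℕ) : ℝ) / (n * Δ)) i = (1 : Matrix (Fin n) (Fin n) ℂ) i m := by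
  rw [← dft_conjTranspose_mul_self hn hΔ, angularSignature_eq, Matrix.mul_apply]
  rfl

/-- Aliasing: this periodicity lets indices near `n` stand for negative directional cosines. -/
theorem beam_sub_inv {n : ℕ} {Δ : ℝ} (hΔ : Δ ≠ 0) (Ω : ℝ) : beam n Δ (Ω - 1 / Δ) = beam n Δ Ω := by
  have hΔ' : (Δ : ℂ) ≠ 0 := by exact_mod_cast hΔ
  simp only [beam, dotProduct, Pi.star_apply]
  refine Finset.sum_congr rfl fun i _ => ?_
  rw [star_signature_mul, star_signature_mul]
  congr 1
  rw [Complex.exp_eq_exp_iff_exists_int]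
  refine ⟨((i : ℕ) : ℤ), ?_⟩
  push_cast; field_simp; ring

theorem angularSignature_sub_inv {n : ℕ} {Δ : ℝ} (hΔ : Δ ≠ 0) (Ω : ℝ) :
    angularSignature n Δ (Ω - 1 / Δ) = angularSignature n Δ Ω := by
  funext m
  rw [angularSignature, angularSignature, ← beam_sub_inv hΔ (Ω - _)]
  congr 1; ring

/-- Uniformly over the directions in the visible region, the signature of an array of length
`L = n Δ` is approximated by linear combinations of `2 (1 + δ) L + 2 D + 1` fixed vectors with an
error that decays geometrically in `D`. -/
theorem exists_matrix_signature_approx {δ : ℝ} (hδ : 0 < δ) :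
    ∃ ρ : ℝ, 0 < ρ ∧ ρ < 1 ∧ ∀ (n : ℕ) (Δ : ℝ), 0 < Δ → ∀ D : ℕ,
      ∃ A : Matrix (Fin n) (Fin (⌊2 * (1 + δ) * (n * Δ)⌋₊ + 2 * D + 1)) ℂ,
      ∀ Ω : ℝ, |Ω| ≤ 1 → ∃ b, ∀ k, ‖signature n Δ Ω k - (A *ᵥ b) k‖ ≤
        1 / √n * (2 * ρ ^ D / (1 - ρ) ^ 2) := by
  have hπ := Real.pi_pos
  have hδ1 : 0 < 1 + δ := by linarith
  obtain ⟨ρ, hρ0, hρ1, H⟩ := exists_polynomial_norm_exp_sub_le (θ₀ := Real.pi / (1 + δ))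
    (by positivity) (by rw [div_lt_iff₀ hδ1]; nlinarith)
  refine ⟨ρ, hρ0, hρ1, fun n Δ hΔ D => ?_⟩
  -- With `θ = -πΩ/(1 + δ)` the `k`-th entry is `e^{i x_k θ}/√n`. Stretching the exponents by `1 +
  -- δ` keeps `|θ|` away from `π`, at the cost of a larger degree.
  set x : Fin n → ℝ := fun k => 2 * (1 + δ) * ((k : ℕ) * Δ) with hx
  have hx0 : ∀ k, 0 ≤ x k := fun k => by positivity
  choose Q hQ1 hQ2 using fun k : Fin n => H (Int.fract (x k)) (Int.fract_nonneg _)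
    (Int.fract_lt_one _).le D
  refine ⟨Matrix.of fun k j => ((1 / √n : ℝ) : ℂ) * (Polynomial.X ^ ⌊x k⌋₊ * Q k).coeff j,
    fun Ω hΩ => ?_⟩
  set θ : ℝ := -(Real.pi / (1 + δ) * Ω) with hθ
  set z := Complex.exp (θ * Complex.I) with hz
  have hz0 : z ≠ 0 := Complex.exp_ne_zero _
  -- All dependence on `Ω` sits in the powers `z^{j - D}`; the polynomial coefficients form the
  -- fixed matrix.
  refine ⟨fun j => z ^ (-(D : ℤ)) * z ^ (j : ℕ), fun k => ?_⟩
  have hθle : |θ| ≤ Real.pi / (1 + δ) := by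
    rw [hθ, abs_neg, abs_mul, abs_of_pos (by positivity)]
    exact mul_le_of_le_one_right (by positivity) hΩ
  have hdeg : (Polynomial.X ^ ⌊x k⌋₊ * Q k).natDegree < ⌊2 * (1 + δ) * (n * Δ)⌋₊ + 2 * D + 1 := by
    have h1 : ⌊x k⌋₊ ≤ ⌊2 * (1 + δ) * (n * Δ)⌋₊ := by
      apply Nat.floor_le_floor
      have : ((k : ℕ) : ℝ) ≤ n := by exact_mod_cast k.2.le
      simp only [hx]
      gcongr
    have h2 : (Polynomial.X ^ ⌊x k⌋₊ * Q k).natDegree ≤ ⌊x k⌋₊ + 2 * D :=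
      Polynomial.natDegree_mul_le_of_le (Polynomial.natDegree_X_pow_le _) (hQ1 k)
    omega
  have hsum : ((Matrix.of fun (k : Fin n) (j : Fin (⌊2 * (1 + δ) * (n * Δ)⌋₊ + 2 * D + 1)) =>
      ((1 / √n : ℝ) : ℂ) * (Polynomial.X ^ ⌊x k⌋₊ * Q k).coeff j) *ᵥ
        fun j => z ^ (-(D : ℤ)) * z ^ (j : ℕ)) k =
      ((1 / √n : ℝ) : ℂ) * (z ^ ⌊x k⌋₊ * (z ^ (-(D : ℤ)) * (Q k).eval z)) := by
    have h3 : (Polynomial.X ^ ⌊x k⌋₊ * Q k).eval z = z ^ ⌊x k⌋₊ * (Q k).eval z := by simp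
    rw [mul_left_comm (z ^ ⌊x k⌋₊), ← h3, Polynomial.eval_eq_sum_range' hdeg, Matrix.mulVec,
      dotProduct, Finset.mul_sum, Finset.mul_sum, Finset.sum_range]
    refine Finset.sum_congr rfl fun j _ => ?_
    simp only [Matrix.of_apply]; ring
  have hsig : signature n Δ Ω k = ((1 / √n : ℝ) : ℂ) *
      (z ^ ⌊x k⌋₊ * Complex.exp (Int.fract (x k) * θ * Complex.I)) := by
    rw [signature, hz, ← Complex.exp_nat_mul, ← Complex.exp_add]
    congr 2
    have h4 : (⌊x k⌋₊ : ℝ) + Int.fract (x k) = x k := by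
      rw [natCast_floor_eq_intCast_floor (hx0 k), Int.floor_add_fract]
    have h5 : (⌊x k⌋₊ : ℂ) + ((Int.fract (x k) : ℝ) : ℂ) = ((x k : ℝ) : ℂ) := by
      exact_mod_cast congrArg (fun r : ℝ => (r : ℂ)) h4
    have h6 : (⌊x k⌋₊ : ℂ) * (θ * Complex.I) + ((Int.fract (x k) : ℝ) : ℂ) * θ * Complex.I =
        ((x k : ℝ) : ℂ) * θ * Complex.I := by rw [← h5]; ring
    rw [h6]
    have h7 : (1 + δ : ℂ) ≠ 0 := by exact_mod_cast hδ1.ne'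
    simp only [hx, hθ]
    push_cast
    field_simp
  rw [hsum, hsig, ← mul_sub, ← mul_sub, norm_mul, norm_mul, norm_pow, hz,
    Complex.norm_exp_ofReal_mul_I, one_pow, one_mul, Complex.norm_real,
    Real.norm_of_nonneg (by positivity)]
  gcongr
  exact hQ2 k θ hθle

/-- The angular-domain signatures of all visible directions are exponentially close to a subspace
of dimension `(2 + δ) L + 1`, given as the range of an isometry. -/
theorem exists_isometry_angularSignature_approx {δ : ℝ} (hδ : 0 < δ) :
    ∃ c K : ℝ, 0 < c ∧ 0 < K ∧ ∀ (n : ℕ) (Δ : ℝ), 0 < n → 0 < Δ →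
      ∃ (J : ℕ) (V : Matrix (Fin n) (Fin J) ℂ), (J : ℝ) ≤ (2 + δ) * (n * Δ) + 1 ∧ Vᴴ * V = 1 ∧
      ∀ Ω : ℝ, |Ω| ≤ 1 → ∑ i, ‖((1 - V * Vᴴ) *ᵥ angularSignature n Δ Ω) i‖ ^ 2 ≤
        K * Real.exp (-(c * (n * Δ))) := by
  -- The excess dimension `δ L` is shared equally: `δ L / 2` for the stretching and `2 D ≤ δ L / 2`
  -- for the truncation degree.
  obtain ⟨ρ, hρ0, hρ1, H⟩ := exists_matrix_signature_approx (δ := δ / 4) (by linarith)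
  have h1ρ : 0 < 1 - ρ := by linarith
  have hlog : Real.log ρ < 0 := Real.log_neg hρ0 hρ1
  refine ⟨-(Real.log ρ * (δ / 2)), 4 / (1 - ρ) ^ 4 * (ρ⁻¹) ^ 2, by nlinarith, by positivity,
    fun n Δ hn hΔ => ?_⟩
  have hn' : (0 : ℝ) < n := by exact_mod_cast hn
  set L : ℝ := n * Δ with hL
  have hL0 : 0 < L := by positivity
  set D := ⌊δ / 4 * L⌋₊ with hD
  obtain ⟨A, hA⟩ := H n Δ hΔ D
  obtain ⟨J, V, R, hJ, hV, hAV⟩ := exists_isometry_mul_eq A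
  have hU := dft_mul_conjTranspose_self hn hΔ
  refine ⟨J, (dft n Δ)ᴴ * V, ?_, ?_, fun Ω hΩ => ?_⟩
  · have h1 : (J : ℝ) ≤ (⌊2 * (1 + δ / 4) * L⌋₊ : ℝ) + 2 * D + 1 := by exact_mod_cast hJ
    have h2 := Nat.floor_le (show 0 ≤ 2 * (1 + δ / 4) * L by positivity)
    have h3 := Nat.floor_le (show 0 ≤ δ / 4 * L by positivity)
    nlinarith
  · rw [Matrix.conjTranspose_mul, Matrix.conjTranspose_conjTranspose, Matrix.mul_assoc,
      ← Matrix.mul_assoc (dft n Δ), hU, Matrix.one_mul, hV]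
  · obtain ⟨b, hb⟩ := hA Ω hΩ
    set s := Matrix.replicateCol Unit (signature n Δ Ω) with hs
    have e1 : ∑ i, ‖((1 - (dft n Δ)ᴴ * V * ((dft n Δ)ᴴ * V)ᴴ) *ᵥ angularSignature n Δ Ω) i‖ ^ 2 =
        frobSq (s - V * Vᴴ * s) := by
      have e2 : (1 - (dft n Δ)ᴴ * V * ((dft n Δ)ᴴ * V)ᴴ) * ((dft n Δ)ᴴ * s) =
          (dft n Δ)ᴴ * (s - V * Vᴴ * s) := by
        rw [Matrix.conjTranspose_mul, Matrix.conjTranspose_conjTranspose, Matrix.sub_mul,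
          Matrix.mul_sub, Matrix.one_mul]
        simp only [Matrix.mul_assoc]
        rw [← Matrix.mul_assoc (dft n Δ) _ s, hU, Matrix.one_mul]
      have e3 : frobSq ((dft n Δ)ᴴ * (s - V * Vᴴ * s)) = frobSq (s - V * Vᴴ * s) := by
        rw [← frobSq_conjTranspose, Matrix.conjTranspose_mul, Matrix.conjTranspose_conjTranspose,
          frobSq_mul_of_isometry _ _ hU, frobSq_conjTranspose]
      rw [← e3, ← e2, angularSignature_eq, hs, ← Matrix.replicateCol_mulVec,
        ← Matrix.replicateCol_mulVec]
      simp [frobSq]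
    rw [e1]
    refine (frobSq_sub_mul_le V hV s (Matrix.replicateCol Unit (R *ᵥ b))).trans ?_
    rw [hs, ← Matrix.replicateCol_mulVec, Matrix.mulVec_mulVec, ← hAV]
    have h4 : frobSq (Matrix.replicateCol Unit (signature n Δ Ω) -
        Matrix.replicateCol Unit (A *ᵥ b)) ≤
        ∑ _i : Fin n, (1 / √n * (2 * ρ ^ D / (1 - ρ) ^ 2)) ^ 2 := by
      simp only [frobSq, Finset.univ_unique, Finset.sum_singleton, Matrix.sub_apply,
        Matrix.replicateCol_apply]
      gcongr with i
      exact hb i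
    have h5 : ∑ _i : Fin n, (1 / √n * (2 * ρ ^ D / (1 - ρ) ^ 2)) ^ 2 =
        4 / (1 - ρ) ^ 4 * (ρ ^ D) ^ 2 := by
      rw [Finset.sum_const, Finset.card_univ, Fintype.card_fin, nsmul_eq_mul, mul_pow, div_pow,
        Real.sq_sqrt hn'.le]
      field_simp
      ring
    -- Rounding `δ L / 4` down to `D` costs at most one factor `ρ⁻¹`.
    have h6 : ρ ^ D ≤ ρ⁻¹ * Real.exp (Real.log ρ * (δ / 4 * L)) := by
      have h7 : δ / 4 * L < D + 1 := Nat.lt_floor_add_one _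
      have h8 : ρ ^ D = ρ⁻¹ * Real.exp (Real.log ρ * (D + 1)) := by
        rw [mul_add, mul_one, Real.exp_add, Real.exp_log hρ0, mul_comm (Real.log ρ),
          Real.exp_nat_mul, Real.exp_log hρ0]
        field_simp
      rw [h8]
      gcongr ρ⁻¹ * ?_
      exact Real.exp_le_exp.2 (mul_le_mul_of_nonpos_left h7.le hlog.le)
    refine (h4.trans_eq h5).trans ?_
    calc 4 / (1 - ρ) ^ 4 * (ρ ^ D) ^ 2
        ≤ 4 / (1 - ρ) ^ 4 * (ρ⁻¹ * Real.exp (Real.log ρ * (δ / 4 * L))) ^ 2 := by gcongr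
      _ = _ := by
        rw [mul_pow, ← Real.exp_nat_mul, mul_assoc]
        congr 3; push_cast; ring

end Signature

/-! ### Energy outside an index set, and projected path integrals. -/

section Truncation

variable {l m n k : Type*} [Fintype l] [Fintype m] [Fintype n] [Fintype k]
  [DecidableEq k]

theorem sum_norm_col_sq_of_hermitian_idempotent {E : Matrix n n ℂ} (h1 : Eᴴ = E) (h2 : E * E = E)
    (j : n) : ∑ i, ‖E i j‖ ^ 2 = (E j j).re := by
  have h3 : (E j j) = ∑ i, star (E i j) * E i j := by
    conv_lhs => rw [← h2]
    rw [Matrix.mul_apply]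
    refine Finset.sum_congr rfl fun i _ => ?_
    rw [← Matrix.conjTranspose_apply, h1]
  rw [h3, Complex.re_sum]
  refine Finset.sum_congr rfl fun i _ => ?_
  rw [Complex.star_def, mul_comm, Complex.mul_conj, Complex.ofReal_re, Complex.normSq_eq_norm_sq]

open scoped Matrix.Norms.L2Operator in
/-- If the range of an isometry `V` almost contains the coordinate vectors in `T` and hardly exceeds
them in dimension, then a matrix whose rows almost lie in that range is small off `T`. -/
theorem sum_compl_norm_sq_le [DecidableEq n] (G : Matrix l n ℂ) (V : Matrix n k ℂ) (hV : Vᴴ * V = 1)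
    (T : Finset n) (e : ℝ) (hT : ∀ j ∈ T, ∑ i, ‖(1 - V * Vᴴ : Matrix n n ℂ) i j‖ ^ 2 ≤ e) :
    ∑ j ∈ Tᶜ, ∑ i, ‖G i j‖ ^ 2 ≤
      2 * (‖G‖ ^ 2 * (Fintype.card k - T.card * (1 - e))) + 2 * frobSq (G * (1 - V * Vᴴ)) := by
  set E := V * Vᴴ with hE
  have hE1 : Eᴴ = E := by simp [hE, Matrix.conjTranspose_mul]
  have hE2 : E * E = E := by
    rw [hE, Matrix.mul_assoc, ← Matrix.mul_assoc Vᴴ, hV, Matrix.one_mul]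
  have hF1 : (1 - E)ᴴ = 1 - E := by simp [hE1]
  have hF2 : (1 - E) * (1 - E) = 1 - E := by
    rw [Matrix.mul_sub, Matrix.mul_one, Matrix.sub_mul, Matrix.one_mul, hE2, sub_self, sub_zero]
  have hcol := sum_norm_col_sq_of_hermitian_idempotent hE1 hE2
  have hcol' := sum_norm_col_sq_of_hermitian_idempotent hF1 hF2
  have htr : ∑ j, (E j j).re = Fintype.card k := by
    have : E.trace = Fintype.card k := by rw [hE, Matrix.trace_mul_comm, hV, Matrix.trace_one]
    have h := congrArg Complex.re this
    rw [Matrix.trace, Complex.re_sum] at h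
    simpa using h
  have hsplit := Finset.sum_add_sum_compl T fun j => (E j j).re
  have hTE : (T.card : ℝ) * (1 - e) ≤ ∑ j ∈ T, (E j j).re := by
    rw [← nsmul_eq_mul]
    refine Finset.card_nsmul_le_sum _ _ _ fun j hj => ?_
    have h := hT j hj
    rw [hcol'] at h
    simp only [Matrix.sub_apply, Matrix.one_apply_eq, Complex.sub_re, Complex.one_re] at h
    linarith
  -- Column `j` of `E` has squared norm `E_jj`; off `T` these sum to the trace minus the share of
  -- `T`.
  have hGE : ∑ j ∈ Tᶜ, ∑ i, ‖(G * E) i j‖ ^ 2 ≤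
      ‖G‖ ^ 2 * (Fintype.card k - T.card * (1 - e)) := by
    calc _ ≤ ∑ j ∈ Tᶜ, ‖G‖ ^ 2 * (E j j).re :=
          Finset.sum_le_sum fun j _ => (sum_norm_mul_col_le G E j).trans_eq (by rw [hcol])
      _ ≤ _ := by
        rw [← Finset.mul_sum]
        gcongr
        linarith
  have hGF : ∑ j ∈ Tᶜ, ∑ i, ‖(G * (1 - E) : Matrix l n ℂ) i j‖ ^ 2 ≤ frobSq (G * (1 - E)) := by
    unfold frobSq
    rw [Finset.sum_comm (s := Finset.univ)]
    exact Finset.sum_le_sum_of_subset_of_nonneg (Finset.subset_univ _)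
      fun _ _ _ => by positivity
  calc ∑ j ∈ Tᶜ, ∑ i, ‖G i j‖ ^ 2
      ≤ ∑ j ∈ Tᶜ, ∑ i, (2 * ‖(G * E) i j‖ ^ 2 + 2 * ‖(G * (1 - E) : Matrix l n ℂ) i j‖ ^ 2) := by
        refine Finset.sum_le_sum fun j _ => Finset.sum_le_sum fun i _ => ?_
        have h1 : G i j = (G * E) i j + (G * (1 - E) : Matrix l n ℂ) i j := by
          rw [← Matrix.add_apply, ← Matrix.mul_add]; simp
        have h2 := norm_add_le ((G * E) i j) ((G * (1 - E) : Matrix l n ℂ) i j)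
        rw [← h1] at h2
        nlinarith [sq_nonneg (‖(G * E) i j‖ - ‖(G * (1 - E) : Matrix l n ℂ) i j‖),
          norm_nonneg (G i j)]
    _ ≤ _ := by
        simp only [Finset.sum_add_distrib, ← Finset.mul_sum]
        gcongr

/-- The product is an integral of rank-one matrices `a u (B v)ᴴ`, each of Frobenius norm at most
`|a| √e`; the norm of the integral is at most the integral of the norms. -/
theorem frobSq_integral_mul_le {P : Type*} [MeasurableSpace P] {μ : Measure P} {a : P → ℂ}
    {u : P → m → ℂ} {v : P → n → ℂ} (ha : Integrable a μ) (hu : ∀ i, Measurable fun p => u p i)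
    (hv : ∀ j, Measurable fun p => v p j) (hu1 : ∀ p, ∑ i, ‖u p i‖ ^ 2 ≤ 1)
    (hv1 : ∀ p, ∑ j, ‖v p j‖ ^ 2 ≤ 1) {B : Matrix n n ℂ} (hB : Bᴴ = B) {e : ℝ} (he : 0 ≤ e)
    (hBv : ∀ p, ∑ j, ‖(B *ᵥ v p) j‖ ^ 2 ≤ e) :
    frobSq ((Matrix.of fun i j => ∫ p, a p * u p i * star (v p j) ∂μ) * B) ≤
      (∫ p, ‖a p‖ ∂μ) ^ 2 * e := by
  have hub : ∀ p i, ‖u p i‖ ≤ 1 := fun p i => by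
    have := (Finset.single_le_sum (f := fun i => ‖u p i‖ ^ 2) (fun _ _ => sq_nonneg _)
      (Finset.mem_univ i)).trans (hu1 p)
    exact (sq_le_one_iff₀ (norm_nonneg _)).1 this
  have hvb : ∀ p j, ‖v p j‖ ≤ 1 := fun p j => by
    have := (Finset.single_le_sum (f := fun j => ‖v p j‖ ^ 2) (fun _ _ => sq_nonneg _)
      (Finset.mem_univ j)).trans (hv1 p)
    exact (sq_le_one_iff₀ (norm_nonneg _)).1 this
  have hstar : ∀ j, Measurable fun p => star (v p j) := fun j =>
    continuous_star.measurable.comp (hv j)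
  have hint : ∀ i j, Integrable (fun p => a p * u p i * star (v p j)) μ := fun i j => by
    refine (ha.mul_bdd (c := 1) (hu i).aestronglyMeasurable
      (Eventually.of_forall fun p => hub p i)).mul_bdd (c := 1) (hstar j).aestronglyMeasurable
      (Eventually.of_forall fun p => ?_)
    rw [norm_star]; exact hvb p j
  have hBstar : ∀ p j, ∑ x, star (v p x) * B x j = star ((B *ᵥ v p) j) := fun p j => by
    rw [Matrix.mulVec, dotProduct, star_sum]
    refine Finset.sum_congr rfl fun x _ => ?_
    rw [star_mul', ← hB, Matrix.conjTranspose_apply, hB, mul_comm]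
  set f : P → EuclideanSpace ℂ (m × n) := fun p =>
    WithLp.toLp 2 fun q => a p * u p q.1 * star ((B *ᵥ v p) q.2) with hf
  have hfi : ∀ q : m × n, (fun p => f p q) =
      fun p => ∑ x, a p * u p q.1 * star (v p x) * B x q.2 := fun q => by
    funext p
    simp only [hf, ← hBstar, Finset.mul_sum, mul_assoc]
  have hfint : ∀ q : m × n, Integrable (fun p => f p q) μ := fun q => by
    rw [hfi]
    exact integrable_finsetSum _ fun x _ => (hint q.1 x).mul_const _
  have hentry : ∀ i j, ((Matrix.of fun i j => ∫ p, a p * u p i * star (v p j) ∂μ) * B) i j =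
      (∫ p, f p ∂μ) (i, j) := fun i j => by
    rw [eval_integral_piLp hfint, hfi,
      integral_finsetSum _ fun x _ => (hint i x).mul_const _, Matrix.mul_apply]
    refine Finset.sum_congr rfl fun x _ => ?_
    rw [integral_mul_const, Matrix.of_apply]
  have hnorm : ∀ p, ‖f p‖ ≤ ‖a p‖ * √e := fun p => by
    refine le_of_sq_le_sq ?_ (by positivity)
    rw [mul_pow, Real.sq_sqrt he, EuclideanSpace.norm_sq_eq, Fintype.sum_prod_type]
    simp only [hf, norm_mul, norm_star, mul_pow, mul_assoc, ← Finset.mul_sum, ← Finset.sum_mul]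
    gcongr
    calc _ ≤ 1 * e := by
          gcongr
          · exact hu1 p
          · exact hBv p
      _ = e := one_mul e
  have hfinal : ‖∫ p, f p ∂μ‖ ≤ (∫ p, ‖a p‖ ∂μ) * √e := by
    rw [← integral_mul_const]
    exact norm_integral_le_of_norm_le (ha.norm.mul_const _) (Eventually.of_forall hnorm)
  have h2 := pow_le_pow_left₀ (norm_nonneg _) hfinal 2
  rw [mul_pow, Real.sq_sqrt he, EuclideanSpace.norm_sq_eq, Fintype.sum_prod_type] at h2
  refine le_trans (le_of_eq ?_) h2
  exact Finset.sum_congr rfl fun i _ => Finset.sum_congr rfl fun j _ => by rw [hentry]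

end Truncation

/-! ### Retained indices as visible grid directions. -/

section Effective

theorem sum_norm_angularSignature_sq {n : ℕ} {Δ : ℝ} (hn : 0 < n) (hΔ : 0 < Δ) (Ω : ℝ) :
    ∑ i, ‖angularSignature n Δ Ω i‖ ^ 2 = 1 := by
  have hn' : (n : ℂ) ≠ 0 := by exact_mod_cast hn.ne'
  have h1 : ∑ i, ‖angularSignature n Δ Ω i‖ ^ 2 =
      frobSq ((Matrix.replicateCol Unit (signature n Δ Ω))ᴴ * dft n Δ) := by
    rw [← frobSq_conjTranspose, Matrix.conjTranspose_mul, Matrix.conjTranspose_conjTranspose,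
      ← Matrix.replicateCol_mulVec, ← angularSignature_eq]
    simp [frobSq]
  rw [h1, frobSq_mul_of_isometry _ _ (dft_mul_conjTranspose_self hn hΔ), frobSq_eq_trace,
    Matrix.trace, Finset.univ_unique, Finset.sum_singleton, Matrix.diag_apply, Matrix.mul_apply]
  simp only [Matrix.conjTranspose_apply, Matrix.replicateCol_apply, star_star, star_signature_mul,
    sub_self, mul_zero, Complex.exp_zero]
  simp [hn']

open Classical in
-- The first `L` and last `L` indices are disjoint. Index `L` is not counted, since it coincides
-- with `n - L` when `n = 2 L`.
theorem two_mul_le_card_effectiveIndices {n L : ℕ} (h : 2 * L ≤ n) :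
    2 * L ≤ (effectiveIndices n L).toFinset.card := by
  have : (Finset.univ : Finset (Fin (2 * L))).card ≤ (effectiveIndices n L).toFinset.card := by
    refine Finset.card_le_card_of_injOn
      (fun i => if (i : ℕ) < L then ⟨i, by omega⟩ else ⟨n - 2 * L + i, by omega⟩) ?_ ?_
    · intro i _
      rw [Finset.mem_coe, Set.mem_toFinset]
      by_cases h : (i : ℕ) < L
      · simp only [if_pos h]; exact Or.inl h.le
      · simp only [if_neg h]; exact Or.inr (show n ≤ n - 2 * L + i + L by omega)
    · intro i _ j _ hij
      apply Fin.ext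
      have := congrArg Fin.val hij
      simp only at this
      split_ifs at this <;> simp at this <;> omega
  simpa using this

/-- The coordinate vector of a retained index is the angular signature of `j/L` or, after aliasing,
of `(j - n)/L`, both in `[-1, 1]`. -/
theorem sum_norm_col_le_of_mem_effectiveIndices {n L : ℕ} {Δ e : ℝ} (hn : 0 < n) (hΔ : 0 < Δ)
    (hL : n * Δ = L) {B : Matrix (Fin n) (Fin n) ℂ}
    (hB : ∀ Ω : ℝ, |Ω| ≤ 1 → ∑ i, ‖(B *ᵥ angularSignature n Δ Ω) i‖ ^ 2 ≤ e)
    {j : Fin n} (hj : j ∈ effectiveIndices n L) : ∑ i, ‖B i j‖ ^ 2 ≤ e := by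
  have hn' : (0 : ℝ) < n := by exact_mod_cast hn
  have hL0 : (0 : ℝ) < L := by rw [← hL]; positivity
  have hgrid : angularSignature n Δ (((j : ℕ) : ℝ) / (n * Δ)) = Pi.single j 1 := by
    funext i
    rw [angularSignature_grid hn hΔ, Matrix.one_apply, Pi.single_apply]
  have key : ∀ Ω : ℝ, |Ω| ≤ 1 → angularSignature n Δ Ω = Pi.single j 1 →
      ∑ i, ‖B i j‖ ^ 2 ≤ e := fun Ω h1 h2 => by
    have h3 := hB Ω h1
    rw [h2] at h3
    simpa using h3
  rcases hj with h | h
  · refine key _ ?_ hgrid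
    rw [hL, abs_of_nonneg (by positivity), div_le_one hL0]
    exact_mod_cast h
  · refine key (((j : ℕ) : ℝ) / (n * Δ) - 1 / Δ) ?_ ?_
    · have h1 : ((j : ℕ) : ℝ) / (n * Δ) - 1 / Δ = (((j : ℕ) : ℝ) - n) / L := by
        rw [← hL]; field_simp
      have h2 : ((j : ℕ) : ℝ) ≤ n := by exact_mod_cast j.2.le
      have h3 : (n : ℝ) ≤ ((j : ℕ) : ℝ) + L := by exact_mod_cast h
      rw [h1, abs_div, abs_of_pos hL0, abs_of_nonpos (by linarith), div_le_one hL0]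
      linarith
    · rw [angularSignature_sub_inv hΔ.ne', hgrid]

end Effective

namespace ArraySystem

variable (S : ArraySystem)

theorem sepT_pos : 0 < S.sepT :=
  div_pos (by exact_mod_cast S.Lt_pos) (by exact_mod_cast S.M_pos)

theorem sepR_pos : 0 < S.sepR :=
  div_pos (by exact_mod_cast S.Lr_pos) (by exact_mod_cast S.N_pos)

theorem M_mul_sepT : (S.M : ℝ) * S.sepT = S.Lt :=
  mul_div_cancel₀ _ (by exact_mod_cast S.M_pos.ne')

theorem N_mul_sepR : (S.N : ℝ) * S.sepR = S.Lr :=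
  mul_div_cancel₀ _ (by exact_mod_cast S.N_pos.ne')

theorem two_mul_Lt_le (h : S.sepT ≤ 1 / 2) : 2 * S.Lt ≤ S.M := by
  have hM : (0 : ℝ) < S.M := by exact_mod_cast S.M_pos
  have h1 := S.M_mul_sepT
  have h2 : (2 * S.Lt : ℝ) ≤ S.M := by nlinarith
  exact_mod_cast h2

theorem two_mul_Lr_le (h : S.sepR ≤ 1 / 2) : 2 * S.Lr ≤ S.N := by
  have hN : (0 : ℝ) < S.N := by exact_mod_cast S.N_pos
  have h1 := S.N_mul_sepR
  have h2 : (2 * S.Lr : ℝ) ≤ S.N := by nlinarith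
  exact_mod_cast h2

end ArraySystem

/-! ### Estimates for a fixed array system. -/

section System

variable {P : Type*} [MeasurableSpace P]

open Classical in
theorem frobSq_sub_truncate_le (S : ArraySystem) (G : Matrix (Fin S.N) (Fin S.M) ℂ) :
    frobSq (G - truncate S G) ≤
      ∑ m ∈ (effectiveIndices S.M S.Lt).toFinsetᶜ, ∑ n, ‖G n m‖ ^ 2 +
      ∑ n ∈ (effectiveIndices S.N S.Lr).toFinsetᶜ, ∑ m, ‖Gᴴ m n‖ ^ 2 := by
  have h1 : ∑ m ∈ (effectiveIndices S.M S.Lt).toFinsetᶜ, ∑ n, ‖G n m‖ ^ 2 =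
      ∑ n, ∑ m, if m ∈ effectiveIndices S.M S.Lt then 0 else ‖G n m‖ ^ 2 := by
    rw [Finset.sum_comm (s := Finset.univ), ← Finset.sum_compl_add_sum
      (effectiveIndices S.M S.Lt).toFinset, add_comm, Finset.sum_eq_zero (s := Set.toFinset _),
      zero_add]
    · refine Finset.sum_congr rfl fun m hm => Finset.sum_congr rfl fun n _ => ?_
      rw [if_neg (by simpa using hm)]
    · intro m hm
      refine Finset.sum_eq_zero fun n _ => if_pos (by simpa using hm)
  have h2 : ∑ n ∈ (effectiveIndices S.N S.Lr).toFinsetᶜ, ∑ m, ‖Gᴴ m n‖ ^ 2 =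
      ∑ n, ∑ m, if n ∈ effectiveIndices S.N S.Lr then 0 else ‖G n m‖ ^ 2 := by
    rw [← Finset.sum_compl_add_sum (s := (effectiveIndices S.N S.Lr).toFinset)
      (f := fun n => ∑ m, _), add_comm, Finset.sum_eq_zero (s := Set.toFinset _), zero_add]
    · refine Finset.sum_congr rfl fun n hn => Finset.sum_congr rfl fun m _ => ?_
      rw [if_neg (by simpa using hn), Matrix.conjTranspose_apply, norm_star]
    · intro n hn
      refine Finset.sum_eq_zero fun m _ => if_pos (by simpa using hn)
  rw [h1, h2]
  simp only [frobSq, ← Finset.sum_add_distrib]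
  refine Finset.sum_le_sum fun n _ => Finset.sum_le_sum fun m _ => ?_
  rw [Matrix.sub_apply, truncate, Matrix.of_apply]
  by_cases hn : n ∈ effectiveIndices S.N S.Lr <;> by_cases hm : m ∈ effectiveIndices S.M S.Lt <;>
    simp [hn, hm]

theorem angularChannel_eq (dp : Measure P) (S : ArraySystem) (C : ChannelInstance P) :
    angularChannel dp S C = Matrix.of fun n m =>
      ∫ p, ((√(4 * S.Lt * S.Lr) : ℝ) : ℂ) * C.a p * angularSignature S.N S.sepR (C.Ωr p) n *
        star (angularSignature S.M S.sepT (C.Ωt p) m) ∂dp := by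
  ext n m
  rw [angularChannel, Matrix.of_apply, Matrix.of_apply, ← integral_const_mul]
  congr 1
  funext p
  rw [angularSignature, angularSignature, S.N_mul_sepR, S.M_mul_sepT]
  ring

theorem conjTranspose_angularChannel_eq (dp : Measure P) (S : ArraySystem)
    (C : ChannelInstance P) :
    (angularChannel dp S C)ᴴ = Matrix.of fun m n =>
      ∫ p, star (((√(4 * S.Lt * S.Lr) : ℝ) : ℂ) * C.a p) *
        angularSignature S.M S.sepT (C.Ωt p) m *
        star (angularSignature S.N S.sepR (C.Ωr p) n) ∂dp := by
  ext m n
  rw [Matrix.conjTranspose_apply, angularChannel_eq, Matrix.of_apply, Matrix.of_apply,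
    Complex.star_def, ← integral_conj]
  congr 1
  funext p
  simp only [map_mul, Complex.conj_conj]
  ring

theorem measurable_angularSignature (n : ℕ) (Δ : ℝ) {Ω : P → ℝ} (hΩ : Measurable Ω) (i : Fin n) :
    Measurable fun p => angularSignature n Δ (Ω p) i :=
  (continuous_beam n Δ).measurable.comp (hΩ.sub_const _)

open scoped Matrix.Norms.L2Operator in
theorem frobSq_sub_truncate_angularChannel_le (dp : Measure P) (S : ArraySystem)
    (C : ChannelInstance P) (hT : S.sepT ≤ 1 / 2) (hR : S.sepR ≤ 1 / 2) {A δ e b : ℝ}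
    (hA : 0 ≤ A) (he : 0 ≤ e) (ha : ∫⁻ p, ‖C.a p‖ₑ ∂dp ≤ ENNReal.ofReal A)
    (hb : ‖angularChannel dp S C‖ ^ 2 ≤ b) (he1 : e ≤ 1) (hδ : 0 ≤ δ)
    {Jt Jr : ℕ} {Vt : Matrix (Fin S.M) (Fin Jt) ℂ} {Vr : Matrix (Fin S.N) (Fin Jr) ℂ}
    (hJt : (Jt : ℝ) ≤ (2 + δ) * S.Lt + 1) (hJr : (Jr : ℝ) ≤ (2 + δ) * S.Lr + 1)
    (hVt : Vtᴴ * Vt = 1) (hVr : Vrᴴ * Vr = 1)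
    (het : ∀ Ω : ℝ, |Ω| ≤ 1 →
      ∑ i, ‖((1 - Vt * Vtᴴ) *ᵥ angularSignature S.M S.sepT Ω) i‖ ^ 2 ≤ e)
    (her : ∀ Ω : ℝ, |Ω| ≤ 1 →
      ∑ i, ‖((1 - Vr * Vrᴴ) *ᵥ angularSignature S.N S.sepR Ω) i‖ ^ 2 ≤ e) :
    frobSq (angularChannel dp S C - truncate S (angularChannel dp S C)) ≤
      2 * (b * ((δ + 2 * e) * (S.Lt + S.Lr) + 2)) + 16 * (S.Lt * S.Lr) * (A ^ 2 * e) := by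
  classical
  have hSt := S.sepT_pos
  have hSr := S.sepR_pos
  set G := angularChannel dp S C with hG
  set a' : P → ℂ := fun p => ((√(4 * S.Lt * S.Lr) : ℝ) : ℂ) * C.a p with ha'
  have hai : Integrable C.a dp :=
    ⟨C.measurable_a.aestronglyMeasurable, ha.trans_lt ENNReal.ofReal_lt_top⟩
  have hai' : Integrable a' dp := hai.const_mul _
  have hnorm : (∫ p, ‖a' p‖ ∂dp) ^ 2 ≤ 4 * S.Lt * S.Lr * A ^ 2 := by
    have h1 : ∫ p, ‖a' p‖ ∂dp = √(4 * S.Lt * S.Lr) * ∫ p, ‖C.a p‖ ∂dp := by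
      rw [← integral_const_mul]
      congr 1; funext p
      rw [ha', norm_mul, Complex.norm_real, Real.norm_of_nonneg (Real.sqrt_nonneg _)]
    have h2 : ∫ p, ‖C.a p‖ ∂dp ≤ A := by
      rw [integral_norm_eq_lintegral_enorm hai.1]
      exact ENNReal.toReal_le_of_le_ofReal hA ha
    have h3 : 0 ≤ ∫ p, ‖C.a p‖ ∂dp := integral_nonneg fun _ => norm_nonneg _
    rw [h1, mul_pow, Real.sq_sqrt (by positivity)]
    gcongr
  have hΩt : ∀ p, |C.Ωt p| ≤ 1 := fun p => abs_le.2 (C.Ωt_mem p)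
  have hΩr : ∀ p, |C.Ωr p| ≤ 1 := fun p => abs_le.2 (C.Ωr_mem p)
  have hproj : ∀ {n J : ℕ} (V : Matrix (Fin n) (Fin J) ℂ),
      (1 - V * Vᴴ)ᴴ = 1 - V * Vᴴ := fun V => by
    simp [Matrix.conjTranspose_sub, Matrix.conjTranspose_mul]
  have hGt : frobSq (G * (1 - Vt * Vtᴴ)) ≤ 4 * S.Lt * S.Lr * A ^ 2 * e := by
    rw [hG, angularChannel_eq]
    refine (frobSq_integral_mul_le hai' (measurable_angularSignature _ _ C.measurable_Ωr)
      (measurable_angularSignature _ _ C.measurable_Ωt)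
      (fun p => (sum_norm_angularSignature_sq S.N_pos hSr _).le)
      (fun p => (sum_norm_angularSignature_sq S.M_pos hSt _).le) (hproj Vt) he
      (fun p => het _ (hΩt p))).trans ?_
    gcongr
  have hGr : frobSq (Gᴴ * (1 - Vr * Vrᴴ)) ≤ 4 * S.Lt * S.Lr * A ^ 2 * e := by
    rw [hG, conjTranspose_angularChannel_eq]
    have hstar : Integrable (fun p => star (a' p)) dp :=
      ⟨continuous_star.comp_aestronglyMeasurable hai'.1,
        hai'.2.mono (Eventually.of_forall fun p => (norm_star _).le)⟩
    refine (frobSq_integral_mul_le hstar (measurable_angularSignature _ _ C.measurable_Ωt)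
      (measurable_angularSignature _ _ C.measurable_Ωr)
      (fun p => (sum_norm_angularSignature_sq S.M_pos hSt _).le)
      (fun p => (sum_norm_angularSignature_sq S.N_pos hSr _).le) (hproj Vr) he
      (fun p => her _ (hΩr p))).trans ?_
    simp only [norm_star]
    gcongr
  -- The `2 L` retained indices cancel the leading part of the dimension.
  have hdim : ∀ {J n L : ℕ}, (J : ℝ) ≤ (2 + δ) * L + 1 → 2 * L ≤ n →
      (J : ℝ) - (effectiveIndices n L).toFinset.card * (1 - e) ≤ (δ + 2 * e) * L + 1 := by
    intro J n L hJ hn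
    have h1 : (2 * L : ℝ) ≤ (effectiveIndices n L).toFinset.card := by
      exact_mod_cast two_mul_le_card_effectiveIndices hn
    nlinarith
  have hb0 : 0 ≤ b := (sq_nonneg _).trans hb
  have h1 := sum_compl_norm_sq_le G Vt hVt (effectiveIndices S.M S.Lt).toFinset e fun j hj =>
    sum_norm_col_le_of_mem_effectiveIndices S.M_pos hSt S.M_mul_sepT het (by simpa using hj)
  have h2 := sum_compl_norm_sq_le Gᴴ Vr hVr (effectiveIndices S.N S.Lr).toFinset e fun j hj =>
    sum_norm_col_le_of_mem_effectiveIndices S.N_pos hSr S.N_mul_sepR her (by simpa using hj)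
  rw [Matrix.l2_opNorm_conjTranspose] at h2
  rw [Fintype.card_fin] at h1 h2
  have h3 := hdim hJt (S.two_mul_Lt_le hT)
  have h4 := hdim hJr (S.two_mul_Lr_le hR)
  have hmul : ∀ {x L : ℝ}, 0 ≤ L → x ≤ (δ + 2 * e) * L + 1 →
      ‖G‖ ^ 2 * x ≤ b * ((δ + 2 * e) * L + 1) := fun {x L} hL hx =>
    (mul_le_mul_of_nonneg_left hx (sq_nonneg _)).trans
      (mul_le_mul_of_nonneg_right hb (by positivity))
  have h5 := hmul (Nat.cast_nonneg _) h3
  have h6 := hmul (Nat.cast_nonneg _) h4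
  have h7 := frobSq_sub_truncate_le S G
  linarith

theorem capacity_dft_conj (S : ArraySystem) (Sg H : Matrix (Fin S.M) (Fin S.M) ℂ) (γ : ℝ)
    (hH : (γ : ℂ) • Sg = H * Hᴴ) (G : Matrix (Fin S.N) (Fin S.M) ℂ) :
    capacity S (dft S.M S.sepT * Sg * (dft S.M S.sepT)ᴴ) γ G =
      Real.log (1 + (G * H) * (G * H)ᴴ).det.re := by
  have hU := dft_conjTranspose_mul_self S.M_pos S.sepT_pos
  have h : G * (dft S.M S.sepT)ᴴ * (dft S.M S.sepT * Sg * (dft S.M S.sepT)ᴴ) *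
      dft S.M S.sepT * Gᴴ = G * Sg * Gᴴ := by
    calc _ = G * (((dft S.M S.sepT)ᴴ * dft S.M S.sepT) * Sg *
          ((dft S.M S.sepT)ᴴ * dft S.M S.sepT)) * Gᴴ := by simp only [Matrix.mul_assoc]
      _ = _ := by rw [hU, Matrix.one_mul, Matrix.mul_one]
  rw [capacity, h, ← Matrix.smul_mul, ← Matrix.mul_smul, hH, Matrix.conjTranspose_mul]
  simp only [Matrix.mul_assoc]

theorem abs_capacity_sub_le (S : ArraySystem) {Sg : Matrix (Fin S.M) (Fin S.M) ℂ}
    (hSg : Sg.PosSemidef) {γ c : ℝ} (hγ : 0 ≤ γ) (hc : ∀ i, hSg.1.eigenvalues i ≤ c)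
    (G G' : Matrix (Fin S.N) (Fin S.M) ℂ) {d : ℝ} (hd : γ * c * frobSq (G - G') ≤ d) :
    |capacity S (dft S.M S.sepT * Sg * (dft S.M S.sepT)ᴴ) γ G -
      capacity S (dft S.M S.sepT * Sg * (dft S.M S.sepT)ᴴ) γ G'| ≤ 2 * (√S.N * √d) + d := by
  obtain ⟨H, hH, hle⟩ := hSg.exists_mul_conjTranspose_frobSq_le (m := Fin S.N) hγ hc
  rw [capacity_dft_conj S Sg H γ hH, capacity_dft_conj S Sg H γ hH]
  refine (abs_log_det_sub_le _ _).trans ?_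
  have h := (hle (G - G')).trans hd
  rw [Matrix.sub_mul] at h
  rw [Fintype.card_fin]
  gcongr

open scoped Matrix.Norms.L2Operator in
theorem norm_sq_le_of_maxSingularValue_le (S : ArraySystem) {G : Matrix (Fin S.N) (Fin S.M) ℂ}
    {B : ℝ} (h : maxSingularValue
      (((Real.sqrt (min (2 * S.Lt) (2 * S.Lr)))⁻¹ : ℝ) • G) ≤ B) :
    ‖G‖ ^ 2 ≤ B ^ 2 * (2 * S.Lt) := by
  have hLt : (0 : ℝ) < S.Lt := by exact_mod_cast S.Lt_pos
  have hLr : (0 : ℝ) < S.Lr := by exact_mod_cast S.Lr_pos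
  have hm : 0 < min (2 * (S.Lt : ℝ)) (2 * (S.Lr : ℝ)) := lt_min (by linarith) (by linarith)
  rw [maxSingularValue, norm_smul, norm_inv, Real.norm_of_nonneg (Real.sqrt_nonneg _),
    inv_mul_le_iff₀ (Real.sqrt_pos.2 hm)] at h
  have h2 := pow_le_pow_left₀ (norm_nonneg _) h 2
  rw [mul_pow, Real.sq_sqrt hm.le, mul_comm] at h2
  exact h2.trans (mul_le_mul_of_nonneg_left (min_le_left _ _) (sq_nonneg _))

end System

/-! ### Passage to the large-system limit. -/

theorem tendsto_Lt_largeSystemLimit (Δr α : ℝ) :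
    Tendsto (fun S : ArraySystem => (S.Lt : ℝ)) (largeSystemLimit Δr α) atTop :=
  tendsto_natCast_atTop_atTop.comp (tendsto_comap.mono_left
    (inf_le_left.trans (inf_le_left.trans (inf_le_left.trans inf_le_left))))

theorem tendsto_Lr_largeSystemLimit (Δr α : ℝ) :
    Tendsto (fun S : ArraySystem => (S.Lr : ℝ)) (largeSystemLimit Δr α) atTop :=
  tendsto_natCast_atTop_atTop.comp (tendsto_comap.mono_left
    (inf_le_left.trans (inf_le_left.trans (inf_le_left.trans inf_le_right))))

theorem eventually_largeSystemLimit (Δr α : ℝ) :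
    ∀ᶠ S in largeSystemLimit Δr α, S.sepT ≤ 1 / 2 ∧ S.sepR = Δr ∧ S.load = α := by
  have h : ∀ᶠ S in largeSystemLimit Δr α,
      S ∈ {S : ArraySystem | S.sepT ∈ Set.Ioc (0 : ℝ) (1 / 2) ∧ S.sepR = Δr ∧ S.load = α} :=
    le_principal_iff.1 inf_le_right
  exact h.mono fun S hS => ⟨hS.1.2, hS.2⟩

/-- In the large-system limit the part of the angular-domain channel removed by the truncation is
negligible in Frobenius norm. -/
theorem eventually_frobSq_sub_truncate_le {P : Type*} [MeasurableSpace P] (dp : Measure P)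
    {Δr α B : ℝ} (hΔr : Δr ≤ 1 / 2) (hα : 0 < α) {𝒞 : ArraySystem → Set (ChannelInstance P)}
    (hB : ∀ᶠ S in largeSystemLimit Δr α, ∀ C ∈ 𝒞 S, maxSingularValue
      (((Real.sqrt (min (2 * S.Lt) (2 * S.Lr)))⁻¹ : ℝ) • angularChannel dp S C) ≤ B)
    (hamp : SubexponentialAmplitude dp Δr α 𝒞) {δ : ℝ} (hδ : 0 < δ) :
    ∀ᶠ S in largeSystemLimit Δr α, ∀ C ∈ 𝒞 S,
      frobSq (angularChannel dp S C - truncate S (angularChannel dp S C)) ≤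
        δ * (4 * B ^ 2 * (3 * α + 4) + 16) * (S.Lt * S.Lr) := by
  obtain ⟨c, K, hc, hK, happ⟩ := exists_isometry_angularSignature_approx hδ
  -- As `L_t = α L_r`, this rate in `L_t` is valid for both arrays.
  set c' := min c (c / α) with hc'
  have hc'0 : 0 < c' := lt_min hc (by positivity)
  have hsmall : Tendsto (fun S : ArraySystem => K * Real.exp (-(c' / 2 * S.Lt)))
      (largeSystemLimit Δr α) (𝓝 (K * 0)) :=
    (Real.tendsto_exp_neg_atTop_nhds_zero.comp
      ((tendsto_Lt_largeSystemLimit Δr α).const_mul_atTop (half_pos hc'0))).const_mul K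
  rw [mul_zero] at hsmall
  -- The squared amplitude costs `e^{c' L_t / 2}`, only half of the decay. The condition `L_r ≥ 2/δ`
  -- absorbs the additive constant from the two dimension bounds.
  filter_upwards [hB, hamp (c' / 4) (by linarith), eventually_largeSystemLimit Δr α,
    hsmall.eventually_le_const (lt_min hδ one_pos),
    (tendsto_Lr_largeSystemLimit Δr α).eventually_ge_atTop (2 / δ)] with S hS1 hS2 hS3 hS4 hS5 C hC
  obtain ⟨hsT, hsR, hload⟩ := hS3
  have hLt : (0 : ℝ) < S.Lt := by exact_mod_cast S.Lt_pos
  have hLr : (0 : ℝ) < S.Lr := by exact_mod_cast S.Lr_pos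
  have hLL : (S.Lt : ℝ) = α * S.Lr := (div_eq_iff hLr.ne').1 hload
  obtain ⟨Jt, Vt, hJt, hVt, het⟩ := happ S.M S.sepT S.M_pos S.sepT_pos
  obtain ⟨Jr, Vr, hJr, hVr, her⟩ := happ S.N S.sepR S.N_pos S.sepR_pos
  rw [S.M_mul_sepT] at hJt het
  rw [S.N_mul_sepR] at hJr her
  set e := K * Real.exp (-(c' * S.Lt)) with he
  set A := Real.exp (c' / 4 * S.Lt) with hA
  have hAe : A ^ 2 * e = K * Real.exp (-(c' / 2 * S.Lt)) := by
    rw [hA, he, ← Real.exp_nat_mul, mul_left_comm, ← Real.exp_add]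
    congr 2; push_cast; ring
  have he0 : 0 ≤ e := by positivity
  have heAe : e ≤ A ^ 2 * e := by
    have : 1 ≤ A := Real.one_le_exp (by positivity)
    nlinarith [mul_nonneg he0 (sub_nonneg.2 this)]
  rw [← hAe] at hS4
  have hAδ : A ^ 2 * e ≤ δ := hS4.trans (min_le_left _ _)
  have hA1 : A ^ 2 * e ≤ 1 := hS4.trans (min_le_right _ _)
  have htle : K * Real.exp (-(c * S.Lt)) ≤ e := by
    rw [he]
    gcongr
    exact min_le_left _ _
  have hrle : K * Real.exp (-(c * S.Lr)) ≤ e := by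
    refine mul_le_mul_of_nonneg_left (Real.exp_le_exp.2 (neg_le_neg ?_)) hK.le
    calc c' * S.Lt ≤ c / α * S.Lt := by gcongr; exact min_le_right _ _
      _ = c * S.Lr := by rw [hLL]; field_simp
  have hmain := frobSq_sub_truncate_angularChannel_le dp S C hsT (hsR.trans_le hΔr)
    (Real.exp_pos _).le he0 (hS2 C hC) (norm_sq_le_of_maxSingularValue_le S (hS1 C hC))
    (heAe.trans hA1) hδ.le hJt hJr hVt hVr (fun Ω h => (het Ω h).trans htle)
    (fun Ω h => (her Ω h).trans hrle)
  have h2 : 2 ≤ δ * S.Lr := by rwa [div_le_iff₀' hδ] at hS5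
  have heδ : e ≤ δ := heAe.trans hAδ
  refine hmain.trans ?_
  have h3 : (δ + 2 * e) * (S.Lt + S.Lr) + 2 ≤ δ * (3 * α + 4) * S.Lr := by
    have : e * (S.Lt + S.Lr : ℝ) ≤ δ * (S.Lt + S.Lr : ℝ) := by gcongr
    rw [hLL] at this ⊢
    linarith
  calc _ ≤ 2 * (B ^ 2 * (2 * S.Lt) * (δ * (3 * α + 4) * S.Lr)) + 16 * (S.Lt * S.Lr) * δ := by
        gcongr
    _ = _ := by ring

theorem theorem1 {P : Type*} [MeasurableSpace P] (dp : Measure P)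
    (γ Δr α : ℝ) (hγ : 0 < γ) (hΔr : Δr ∈ Set.Ioc (0 : ℝ) (1 / 2)) (hα : 0 < α)
    (s : ℕ → ℕ) (hs : SlowlyDiverging s)
    (𝒞 : ArraySystem → Set (ChannelInstance P))
    (h𝒞 : ChannelAssumption dp Δr α s 𝒞)
    (hamp : SubexponentialAmplitude dp Δr α 𝒞)
    (𝒮 : (S : ArraySystem) → Set (Matrix (Fin S.M) (Fin S.M) ℂ))
    (h𝒮 : CovarianceAssumption Δr α 𝒮) :
    ∀ ε : ℝ, 0 < ε → ∀ᶠ S in largeSystemLimit Δr α, ∀ Sg ∈ 𝒮 S, ∀ C ∈ 𝒞 S,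
      |capacity S (dft S.M S.sepT * Sg * (dft S.M S.sepT)ᴴ) γ (angularChannel dp S C) -
        capacity S (dft S.M S.sepT * Sg * (dft S.M S.sepT)ᴴ) γ
          (truncate S (angularChannel dp S C))| / (2 * min (S.Lt : ℝ) (S.Lr : ℝ)) < ε := by
  intro ε hε
  obtain ⟨-, B, hB⟩ := h𝒞
  obtain ⟨hpos, B', hB'⟩ := h𝒮
  set b := max B' 1 with hb
  have hb0 : 0 < b := lt_max_of_lt_right one_pos
  set μ := min α 1 with hμ
  have hμ0 : 0 < μ := lt_min hα one_pos
  have hΔ0 := hΔr.1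
  -- For `x = 2 min(L_t, L_r)` one has `N = x / (2 Δ_r μ)`. A squared perturbation of at most `η x`
  -- then changes the capacity by at most `2 (ε/4) x + (ε/4) x < ε x`.
  obtain ⟨η, hη0, hη1, hη2⟩ : ∃ η : ℝ, 0 < η ∧ η ≤ ε / 4 ∧
      η / (2 * Δr * μ) ≤ (ε / 4) ^ 2 :=
    ⟨min (ε / 4) ((ε / 4) ^ 2 * (2 * Δr * μ)), lt_min (by positivity) (by positivity),
      min_le_left _ _, by rw [div_le_iff₀ (by positivity)]; exact min_le_right _ _⟩
  set κ := γ * (b / 2) * (4 * B ^ 2 * (3 * α + 4) + 16) with hκ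
  have hκ0 : 0 < κ := by positivity
  have hfrob := eventually_frobSq_sub_truncate_le dp hΔr.2 hα
    (hB.mono fun S h C hC => (h C hC).2) hamp (δ := η * (2 * μ) / κ) (by positivity)
  filter_upwards [hfrob, hB', eventually_largeSystemLimit Δr α] with S hS1 hS2 hS3 Sg hSg C hC
  obtain ⟨-, hsR, hload⟩ := hS3
  have hLt : (0 : ℝ) < S.Lt := by exact_mod_cast S.Lt_pos
  have hLr : (0 : ℝ) < S.Lr := by exact_mod_cast S.Lr_pos
  have hLL : (S.Lt : ℝ) = α * S.Lr := (div_eq_iff hLr.ne').1 hload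
  have hmin : min (S.Lt : ℝ) S.Lr = μ * S.Lr := by
    rw [hLL, hμ, min_mul_of_nonneg _ _ hLr.le, one_mul]
  have hN : (S.N : ℝ) = S.Lr / Δr := by
    rw [eq_div_iff hΔ0.ne', ← hsR, S.N_mul_sepR]
  have hps := (hpos S Sg hSg).1
  have heig : ∀ i, hps.1.eigenvalues i ≤ b / (2 * S.Lt) := fun i => by
    rw [le_div_iff₀' (by positivity)]
    exact (hS2 Sg hSg hps.1 i).trans (le_max_left _ _)
  set x : ℝ := 2 * (μ * S.Lr) with hx
  have hx0 : 0 < x := by positivity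
  have hd : γ * (b / (2 * S.Lt)) *
      frobSq (angularChannel dp S C - truncate S (angularChannel dp S C)) ≤ η * x := by
    calc _ ≤ γ * (b / (2 * S.Lt)) * (η * (2 * μ) / κ * (4 * B ^ 2 * (3 * α + 4) + 16) *
          (S.Lt * S.Lr)) := by gcongr; exact hS1 C hC
      _ = κ / κ * (η * x) := by rw [hx, hκ]; field_simp
      _ = η * x := by rw [div_self hκ0.ne', one_mul]
  have hcap := abs_capacity_sub_le S hps hγ.le heig _ _ hd
  rw [hmin, ← hx, div_lt_iff₀ hx0]
  have hsq : √S.N * √(η * x) ≤ ε / 4 * x := by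
    rw [← Real.sqrt_mul (Nat.cast_nonneg _)]
    refine Real.sqrt_le_iff.2 ⟨by positivity, ?_⟩
    have : (S.N : ℝ) * (η * x) = η / (2 * Δr * μ) * x ^ 2 := by
      rw [hN, hx]; field_simp
    rw [this, mul_pow (ε / 4)]
    exact mul_le_mul_of_nonneg_right hη2 (sq_nonneg x)
  nlinarith
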